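/- **Setting.** There are finitely many robots; robot $i$ is a weighted transition system on a finite set of regions $R$, with initial region $q_i^0$, transition relation $\to_i$ and weights $w_i\ge 0$. States of the product transition system (PTS) are tuples $x=(x_i)_i$; $x\to_{\rm PTS}x'$ iff $x_i\to_i x_i'$ for all $i$; the label of $x$ is $L(x)=\{(i,x_i)\}_i$ (robot $i$ is in region $x_i$). Let $B$ be a Büchi automaton with finite state set $\mathcal Q_B$ over sets of such propositions. The product automaton has states $q=(x,b)$, transitions $(x,b)\to_P(x',b')$ iff $x\to_{\rm PTS}x'$ and $b\xrightarrow{L(x)}_B b'$, and weights $w_P(q,q')=\sum_i w_i(x_i,x_i')$. The cost $\hat J$ of a finite path is the sum of its weights. A plan consists of a path (prefix) from an initial state to an accepting state $f$ and a cycle (suffix) from $f$ to $f$; its cost is $\beta\hat J(\text{prefix})+(1-\beta)\hat J(\text{suffix})$ with $\beta\in[0,1]$. **Algorithm.** The tree starts as a single root. In iteration $n=1,\dots,n_{\max}$ a node $q^{\rm rand}=(x^{\rm rand},b^{\rm rand})$ of the tree is drawn from a density $f^n_{\rm rand}$ that is positive exactly on the nodes of the tree, and then $x^{\rm new}$ is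 drawn from a density $f^n_{\rm new}(\cdot\mid q^{\rm rand})$ that is positive exactly on $\{x: x^{\rm rand}\to_{\rm PTS}x\}$ (possibly no sample is taken, with some probability). Both densities may depend on the past. For each $b\in\mathcal Q_B$, one after the other, let $q=(x^{\rm new},b)$. If $q$ is not in the tree and some node has a transition to $q$, then $q$ is added, its parent being such a node that makes the cost of $q$ (the cost of the tree path from the root to $q$) least. Then, if $q$ is in the tree, every node $a$ with $q\to_P a$ gets $q$ as its new parent whenever this strictly lowers the cost of $a$. **Theorem.** Let $\texttt p^*=q^1,\dots,q^K$ be either the prefix of a plan of least cost (with $\beta>0$), or the suffix of such a plan without its final return to the first state (with $\beta<1$), and run the algorithm with root $q^1$. For a state $q=(x,b)$, when $V$ is the set of nodes before iteration $n$, put $$P_n^{\rm new}(q)=\sum_{a\in V,\ a\to_P q} f_{\rm rand}^n(a)\,f_{\rm new}^n(x\mid a),\qquad P_n^{\rm add}(q)=\begin{cases}1,& q\in V,\\ P_n^{\rm new}(q),& q\notin V.\end{cases}$$ * Let $\alpha_n(\texttt p^*)$ be the least value, over all histories of positive probability before iteration $n$, of $P_n^{\rm add}(q^{k})$, where the index $k$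 is $1$ before iteration $1$ and is replaced by $\min(k+1,K)$ after each iteration at whose end $q^k$ is in the tree. * For $k\ge2$ let $\gamma_n(q^k)$ be the least value of $P_n^{\rm new}(q^k)$ over all histories of positive probability before iteration $n$ after which all of $q^1,\dots,q^K$ are in the tree ($\gamma_n(q^k)=1$ if there is none), and let $\gamma_n(q^1)=1$. Then $\alpha_n(\texttt p^*),\gamma_n(q^k)\in(0,1]$ for all $n\ge1$, $1\le k\le K$. Moreover, let $n_{\max}>2K$ and $0\le\bar n\le n_{\max}-K$. Let $A$ be the event that $q^1,\dots,q^K$ are in the tree after $\bar n$ iterations. Let $n_0=\bar n$, $n_1=\bar n+1$ and, for $k\ge2$, let $n_k$ be the (random) first iteration in $(n_{k-1},n_{\max}]$ whose sample is the PTS part of $q^k$ ($n_k=n_{\max}+1$ if there is none). Let $\mathbb E_k$ be the conditional expectation given $A$ and $n_{k-1}\le n_{\max}$ (read as $0$ if this condition has probability $0$), and let $(x)_+=\max(x,0)$. Then the probability that after $n_{\max}$ iterations the tree contains $q^K$ and its path from the root to $q^K$ is a path of the product automaton with the same cost as $\texttt p^*$ is at least $$\prod_{k=1}^{K-1}\mathbb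 E_k\Big[\big(1-e^{-\frac12\sum_{n=n_{k-1}}^{n_{\max}}\gamma_n(q^k)+1}\big)_+\Big]\cdot\big(1-e^{-\frac12\sum_{n=1}^{\bar n}\alpha_n(\texttt p^*)+K}\big)_+ .$$ If $\texttt p^*$ is the only path of least cost from $q^1$ to $q^K$ in the product automaton, the same bound holds for the probability that the tree path from the root to $q^K$ is $\texttt p^*$ itself. -/

import Mathlib

open scoped NNReal ENNReal ProbabilityTheory

noncomputable section

namespace Stylus

/-! ### Transition systems, automata, product automaton -/

/-- Weighted transition system of one robot. A state is identified with the region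
(an element of `R`) in which the robot is. -/
structure WTS (R : Type*) where
  init : R
  trans : R → R → Prop
  weight : R → R → ℝ≥0

/-- Nondeterministic Büchi automaton with state set `Q` over the alphabet `2 ^ AP`. -/
structure NBA (AP Q : Type*) where
  init : Set Q
  final : Set Q
  trans : Q → Set AP → Q → Prop

/-- A planning problem: one transition system per robot and a Büchi automaton over the atomic
propositions `(i, r)`, read "robot `i` is in region `r`". -/
structure Model (ι R QB : Type*) where
  robot : ι → WTS R
  nba : NBA (ι × R) QB

/-- States of the product Büchi automaton: a product transition system state together with an
automaton state. -/
abbrev PState (ι R QB : Type*) : Type _ := (ι → R) × QB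

variable {ι R QB : Type*}

namespace Model

/-- Transition relation of the product transition system: all robots move synchronously. -/
def ptsTrans (M : Model ι R QB) (x y : ι → R) : Prop :=
  ∀ i, (M.robot i).trans (x i) (y i)

/-- Atomic propositions that hold at a state of the product transition system. -/
def label (x : ι → R) : Set (ι × R) := Set.range fun i => (i, x i)

/-- Transition relation of the product Büchi automaton. -/
def trans (M : Model ι R QB) (q q' : PState ι R QB) : Prop :=
  M.ptsTrans q.1 q'.1 ∧ M.nba.trans q.2 (label q.1) q'.2

/-- Initial states of the product Büchi automaton. -/
def initStates (M : Model ι R QB) : Set (PState ι R QB) :=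
  {q | (∀ i, q.1 i = (M.robot i).init) ∧ q.2 ∈ M.nba.init}

/-- Accepting states of the product Büchi automaton. -/
def finalStates (M : Model ι R QB) : Set (PState ι R QB) := {q | q.2 ∈ M.nba.final}

/-- `l` is a finite path from `a` to `b` in the product Büchi automaton. -/
structure IsPath (M : Model ι R QB) (a b : PState ι R QB) (l : List (PState ι R QB)) :
    Prop where
  head : l.head? = some a
  last : l.getLast? = some b
  chain : l.IsChain M.trans

variable [Fintype ι]

/-- Weight of a transition of the product: the sum of the weights of the robots' moves. -/
def weight (M : Model ι R QB) (q q' : PState ι R QB) : ℝ≥0 :=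
  ∑ i, (M.robot i).weight (q.1 i) (q'.1 i)

/-- Cost of a finite sequence of states: the sum of the weights of its steps. -/
def pathCost (M : Model ι R QB) : List (PState ι R QB) → ℝ≥0
  | [] => 0
  | [_] => 0
  | a :: b :: l => M.weight a b + M.pathCost (b :: l)

/-- A plan in prefix-suffix form: `pre` leads from an initial state to an accepting state `f`,
and `cyc` is a cycle (with at least one transition) from `f` back to `f`. -/
def IsPlan (M : Model ι R QB) (pre cyc : List (PState ι R QB)) : Prop :=
  ∃ q₀ ∈ M.initStates, ∃ f ∈ M.finalStates,
    M.IsPath q₀ f pre ∧ M.IsPath f f cyc ∧ 2 ≤ cyc.length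

/-- The objective `J = β Ĵ(prefix) + (1 - β) Ĵ(suffix)`. -/
def planCost (M : Model ι R QB) (β : ℝ) (pre cyc : List (PState ι R QB)) : ℝ :=
  β * M.pathCost pre + (1 - β) * M.pathCost cyc

/-- A plan in prefix-suffix form of least cost. -/
def IsOptimalPlan (M : Model ι R QB) (β : ℝ) (pre cyc : List (PState ι R QB)) : Prop :=
  M.IsPlan pre cyc ∧
    ∀ pre' cyc', M.IsPlan pre' cyc' → M.planCost β pre cyc ≤ M.planCost β pre' cyc'

/-- `p` is the prefix part of an optimal plan, or its suffix part without the final return to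
its first state (so that the last state of `p` has a transition to the first one). The part has
to enter the objective with a nonzero coefficient. -/
def IsOptimalPart (M : Model ι R QB) (β : ℝ) (p : List (PState ι R QB)) : Prop :=
  (0 < β ∧ ∃ cyc, M.IsOptimalPlan β p cyc) ∨
    (β < 1 ∧ ∃ pre cyc, M.IsOptimalPlan β pre cyc ∧ p = cyc.dropLast)

end Model

/-! ### The tree and its incremental construction -/

/-- A tree on states of the product automaton: its nodes, and the parent of each node
(`none` for the root). -/
structure Tree (ι R QB : Type*) where
  nodes : Finset (PState ι R QB)
  parent : PState ι R QB → Option (PState ι R QB)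

namespace Tree

/-- Trace at most `n` parents back from `q`; the result is listed from the oldest ancestor
to `q`. -/
def traceBack (parent : PState ι R QB → Option (PState ι R QB)) :
    ℕ → PState ι R QB → List (PState ι R QB)
  | 0, q => [q]
  | n + 1, q =>
    match parent q with
    | none => [q]
    | some a => traceBack parent n a ++ [q]

/-- The path of the tree from the root to `q`. -/
def branch (t : Tree ι R QB) (q : PState ι R QB) : List (PState ι R QB) :=
  traceBack t.parent t.nodes.card q

variable [Fintype ι]

/-- `Cost(q)`: the cost of the path of the tree from the root to `q`. -/
def cost (M : Model ι R QB) (t : Tree ι R QB) (q : PState ι R QB) : ℝ≥0 :=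
  M.pathCost (t.branch q)

/-- The tree that consists of the root `r` only. -/
def single (r : PState ι R QB) : Tree ι R QB := ⟨{r}, fun _ => none⟩

open Classical in
/-- The extend step: if some node has a transition to `q`, add `q` to the tree, with a parent
among these nodes that makes the cost of `q` least (ties are broken arbitrarily). -/
def extend (M : Model ι R QB) (t : Tree ι R QB) (q : PState ι R QB) : Tree ι R QB :=
  if h : (t.nodes.filter fun a => M.trans a q).Nonempty then
    ⟨insert q t.nodes, Function.update t.parent q (some (Classical.choose
      (Finset.exists_min_image (t.nodes.filter fun a => M.trans a q)
        (fun a => t.cost M a + M.weight a q) h)))⟩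
  else t

open Classical in
/-- The rewire step: go through the nodes `a` that `q` has a transition to, and make `q` the
parent of `a` whenever this strictly lowers the cost of `a`. -/
def rewire (M : Model ι R QB) (t : Tree ι R QB) (q : PState ι R QB) : Tree ι R QB :=
  (t.nodes.filter fun a => M.trans q a).toList.foldl
    (fun s a =>
      if s.cost M q + M.weight q a < s.cost M a then
        ⟨s.nodes, Function.update s.parent a (some q)⟩
      else s) t

open Classical in
/-- Treatment of one candidate state `q`: extend the tree towards `q` if `q` is not a node, and
then rewire through `q` if `q` is a node. -/
def process (M : Model ι R QB) (t : Tree ι R QB) (q : PState ι R QB) : Tree ι R QB :=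
  let s := if q ∈ t.nodes then t else t.extend M q
  if q ∈ s.nodes then s.rewire M q else s

/-- One iteration with sample `x`: all states `(x, b)` are treated, with `b` running through an
enumeration of the automaton states. Nothing happens if no sample was taken. -/
def step [Fintype QB] (M : Model ι R QB) (t : Tree ι R QB) : Option (ι → R) → Tree ι R QB
  | none => t
  | some x => (Finset.univ : Finset QB).toList.foldl (fun s b => s.process M (x, b)) t

end Tree

/-- The samples taken so far, the most recent one first (`none`: no sample was taken). -/
abbrev History (ι R : Type*) : Type _ := List (Option (ι → R))

instance historyMeasurableSpace : MeasurableSpace (History ι R) := ⊤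

namespace History

/-- The part of the history that consists of the first `m` iterations. -/
def past (h : History ι R) (m : ℕ) : History ι R := h.drop (h.length - m)

variable [Fintype ι] [Fintype QB]

/-- The tree rooted at `r` after the iterations recorded in a history. -/
def tree (M : Model ι R QB) (r : PState ι R QB) : History ι R → Tree ι R QB
  | [] => Tree.single r
  | x :: h => (tree M r h).step M x

end History

/-! ### Sampling -/

/-- The sampling densities. In the iteration that follows the history `h` a node `q` of the tree
is drawn from `rand h`, and then the sample is drawn from `new h q`. The density `rand h` lives on
the nodes of the tree and is positive at each of them; `new h q` lives on the states that are
reachable in one hop from the product transition system part of `q` (apart from the possibility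
that no sample is taken), and it is positive at each of them. Both may change with the iteration
and the current tree, since both are encoded in `h`. -/
structure Sampler [Fintype ι] [Fintype QB] (M : Model ι R QB) (r : PState ι R QB) where
  rand : History ι R → PMF (PState ι R QB)
  new : History ι R → PState ι R QB → PMF (Option (ι → R))
  rand_support : ∀ h, (rand h).support = ((h.tree M r).nodes : Set (PState ι R QB))
  new_support : ∀ h, ∀ q ∈ (h.tree M r).nodes, ∀ x,
    some x ∈ (new h q).support ↔ M.ptsTrans q.1 x

namespace Sampler

variable [Fintype ι] [Fintype QB] {M : Model ι R QB} {r : PState ι R QB}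

/-- Law of the history of the first `n` iterations. -/
def runLaw (S : Sampler M r) : ℕ → PMF (History ι R)
  | 0 => PMF.pure []
  | n + 1 => (S.runLaw n).bind fun h => ((S.rand h).bind (S.new h)).map fun x => x :: h

/-- The same law as a measure. -/
def runMeasure (S : Sampler M r) (n : ℕ) : MeasureTheory.Measure (History ι R) :=
  (S.runLaw n).toMeasure

open Classical in
/-- `P_n^new(q)`, as a function of the history `h` that precedes iteration `n`: the sum of
`f_rand(a) f_new(q_PTS | a)` over the nodes `a` of the tree with a transition to `q`. -/
def newProb (S : Sampler M r) (h : History ι R) (q : PState ι R QB) : ℝ :=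
  ∑ a ∈ (h.tree M r).nodes.filter (fun a => M.trans a q),
    (S.rand h a).toReal * (S.new h a (some q.1)).toReal

open Classical in
/-- `P_n^add(q)`, as a function of the history `h` that precedes iteration `n`. -/
def addProb (S : Sampler M r) (h : History ι R) (q : PState ι R QB) : ℝ :=
  if q ∈ (h.tree M r).nodes then 1 else S.newProb h q

/-- The `k`-th state of the path `p`, for `k = 1, …, K`. -/
def pathState (_S : Sampler M r) (p : List (PState ι R QB)) (k : ℕ) : PState ι R QB :=
  p.getD (k - 1) r

open Classical in
/-- The index `k` for which `Y_n = X_k^n`, as a function of the history that precedes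
iteration `n`. It is `1` at first; it increases by one (up to `K`) after each iteration at whose
end the `k`-th state of `p` is in the tree, and stays the same otherwise. -/
def pathIndex (S : Sampler M r) (p : List (PState ι R QB)) : History ι R → ℕ
  | [] => 1
  | x :: h =>
    if S.pathState p (S.pathIndex p h) ∈ (History.tree M r (x :: h)).nodes then
      min (S.pathIndex p h + 1) p.length
    else S.pathIndex p h

/-- `α_n(p)`: the success probability `P_n^add(q^k)` of `Y_n`. As this probability depends on
the tree grown so far, its least value over all possible histories is taken. -/
def alpha (S : Sampler M r) (p : List (PState ι R QB)) (n : ℕ) : ℝ :=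
  sInf {a | ∃ h ∈ (S.runLaw (n - 1)).support,
    a = S.addProb h (S.pathState p (S.pathIndex p h))}

/-- The possible values of `P_n^new(q^k)`, given that all states of `p` are in the tree. -/
def newProbValues (S : Sampler M r) (p : List (PState ι R QB)) (n k : ℕ) : Set ℝ :=
  {a | ∃ h ∈ (S.runLaw (n - 1)).support,
    (∀ q ∈ p, q ∈ (h.tree M r).nodes) ∧ a = S.newProb h (S.pathState p k)}

open Classical in
/-- `γ_n(q^k)`: the least possible value of `P_n^new(q^k)` given that all states of `p` are in
the tree (`1` if they cannot be in the tree yet). The root (`k = 1`) need not be sampled again,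
and its parameter is `1`. -/
def gamma (S : Sampler M r) (p : List (PState ι R QB)) (n k : ℕ) : ℝ :=
  if 2 ≤ k ∧ (S.newProbValues p n k).Nonempty then sInf (S.newProbValues p n k) else 1

/-- The iterations `n_k` of a run: `n_0 = n̄`, `n_1 = n̄ + 1`, and for `k ≥ 2`, `n_k` is the first
iteration after `n_{k-1}` at which the `k`-th state of `p` is sampled (that is, at which its
product transition system part is the sample); it is `n_max + 1` if there is no such iteration up
to `n_max`. -/
def selTime (S : Sampler M r) (p : List (PState ι R QB)) (nbar nmax : ℕ)
    (h : History ι R) : ℕ → ℕ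
  | 0 => nbar
  | 1 => nbar + 1
  | k + 2 => sInf ({n | S.selTime p nbar nmax h (k + 1) < n ∧ n ≤ nmax ∧
      (h.past n).head? = some (some (S.pathState p (k + 2)).1)} ∪ {nmax + 1})

/-- The event that all states of `p` are in the tree after `m` iterations. -/
def allAdded (_S : Sampler M r) (p : List (PState ι R QB)) (m : ℕ) : Set (History ι R) :=
  {h | ∀ q ∈ p, q ∈ ((h.past m).tree M r).nodes}

/-- The positive part of `1 - exp (- s / 2 + c)`. -/
def tail (s c : ℝ) : ℝ := max 0 (1 - Real.exp (-s / 2 + c))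

/-- The lower bound on the detection probability. The `k`-th factor of the product is averaged
over the random iteration `n_{k-1}`, given that all states of `p` are in the tree after `n̄`
iterations and that `n_{k-1} ≤ n_max`. -/
def rateBound (S : Sampler M r) (p : List (PState ι R QB)) (nbar nmax : ℕ) : ℝ :=
  (∏ k ∈ Finset.Ico 1 p.length,
    ∫ h, tail (∑ n ∈ Finset.Icc (S.selTime p nbar nmax h (k - 1)) nmax, S.gamma p n k) 1
      ∂(S.runMeasure nmax)[|S.allAdded p nbar ∩ {h | S.selTime p nbar nmax h (k - 1) ≤ nmax}]) *
  tail (∑ n ∈ Finset.Icc 1 nbar, S.alpha p n) p.length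

/-- The event that the path of the tree from the root to `g` is a path of the product automaton
from the root to `g` whose cost is that of `p`. -/
def detects (_S : Sampler M r) (p : List (PState ι R QB)) (g : PState ι R QB) :
    Set (History ι R) :=
  {h | g ∈ (h.tree M r).nodes ∧ M.IsPath r g ((h.tree M r).branch g) ∧
    M.pathCost ((h.tree M r).branch g) = M.pathCost p}

end Sampler

end Stylus

end

namespace Stylus

/-! ### Invariants of the tree under extending and rewiring. -/

section TreeTheory

variable {ι R QB : Type*}

/-! An exchange argument (`Model.IsOptimalPart.isPath_and_le`) shows that `p` is a cheapest path
from `r` to `g`. Branches of the tree are always paths of the product automaton, so no branch to `g`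
is cheaper than `p`, and it suffices to bound the cost of `g` from above.

Costs never increase (`Tree.Improves`). Suppose that all of `q^1, …, q^K` are in the tree. If `q^k`
already costs no more than the initial piece of `p` ending in it, then sampling its PTS part rewires
`q^(k+1)` to within the next piece. Samples of `q^2, …, q^(K-1)` in this order therefore bring the
cost of `g` down to that of `p` (`Sampler.cost_pathState_le`). The edge out of the root needs no
sample: the root competes for parenthood whenever one of its successors is added.

Two estimates give the probability. Up to iteration `nbar`, the exponential of the number of states
still waited for is a potential whose conditional mean shrinks by `exp (-α / 2)` in each iteration
(`Sampler.expect_potential_le`); Markov's inequality then bounds the probability that a state of `p`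
is missing. Afterwards, whether `n_(k-1) = m` is decided by the first `m` iterations, and from there
`q^k` goes unsampled with probability at most `exp (-∑ γ)` (`Sampler.expect_no_sample_le`). Summing
over `m` shows that the `k`-th factor of the bound, times the probability that `n_(k-1)` exists, is
at most the probability that `n_k` exists; these inequalities telescope
(`Sampler.rateBound_le_reached`). -/

theorem Model.pathCost_concat [Fintype ι] (M : Model ι R QB) {l : List (PState ι R QB)}
    {a : PState ι R QB} (h : l.getLast? = some a) (q : PState ι R QB) :
    M.pathCost (l ++ [q]) = M.pathCost l + M.weight a q := by
  induction l with
  | nil => simp at h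
  | cons b l ih =>
    cases l with
    | nil =>
      obtain rfl : b = a := by simpa using h
      simp [Model.pathCost]
    | cons c l =>
      have h' : (c :: l).getLast? = some a := by simpa [List.getLast?_cons_cons] using h
      have := ih h'
      simp only [List.cons_append, Model.pathCost] at this ⊢
      rw [this, add_assoc]

/-- `Traces M t r q l`: following parents from the node `q` leads to the root `r` along
transitions of the product automaton, and `l` lists the states met, from `r` to `q`. -/
inductive Tree.Traces (M : Model ι R QB) (t : Tree ι R QB) (r : PState ι R QB) :
    PState ι R QB → List (PState ι R QB) → Prop
  | root : r ∈ t.nodes → t.parent r = none → Traces M t r r [r]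
  | step {q a : PState ι R QB} {l : List (PState ι R QB)} : q ∈ t.nodes → t.parent q = some a →
      M.trans a q → Traces M t r a l → Traces M t r q (l ++ [q])

namespace Tree

variable {M : Model ι R QB} {t s : Tree ι R QB} {r q a : PState ι R QB}
  {l : List (PState ι R QB)}

namespace Traces

theorem getLast? (h : Traces M t r q l) : l.getLast? = some q := by
  cases h <;> simp

theorem mem (h : Traces M t r q l) : q ∈ t.nodes := by
  cases h <;> assumption

theorem subset (h : Traces M t r q l) : ∀ b ∈ l, b ∈ t.nodes := by
  induction h with
  | root h _ => simpa using h
  | step h _ _ _ ih =>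
    intro b hb
    rcases List.mem_append.1 hb with hb | hb
    · exact ih b hb
    · rw [List.mem_singleton.1 hb]; exact h

theorem isPath (h : Traces M t r q l) : M.IsPath r q l := by
  refine ⟨?_, h.getLast?, ?_⟩
  · induction h with
    | root => rfl
    | step _ _ _ _ ih => rw [List.head?_append, ih]; rfl
  · induction h with
    | root => exact List.isChain_singleton _
    | step _ _ htr hl ih =>
      refine List.IsChain.append ih (List.isChain_singleton _) ?_
      intro x hx y hy
      rw [hl.getLast?] at hx
      simp only [Option.mem_def, Option.some.injEq, List.head?_cons] at hx hy
      subst hx hy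
      exact htr

theorem unique (h : Traces M t r q l) {l' : List (PState ι R QB)} (h' : Traces M t r q l') :
    l = l' := by
  induction h generalizing l' with
  | root _ hn =>
    cases h' with
    | root => rfl
    | step _ hp _ _ => rw [hn] at hp; cases hp
  | step _ hp _ _ ih =>
    cases h' with
    | root _ hn => rw [hn] at hp; cases hp
    | step _ hp' _ hl' =>
      rw [hp] at hp'
      cases hp'
      rw [ih hl']

theorem exists_prefix (h : Traces M t r q l) (ha : a ∈ l) :
    ∃ l', l' <+: l ∧ Traces M t r a l' := by
  induction h with
  | root h hn =>
    obtain rfl := List.mem_singleton.1 ha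
    exact ⟨_, List.prefix_rfl, .root h hn⟩
  | step h hp htr hl ih =>
    rcases List.mem_append.1 ha with ha | ha
    · obtain ⟨l', hl', ht⟩ := ih ha
      exact ⟨l', hl'.trans (List.prefix_append _ _), ht⟩
    · obtain rfl := List.mem_singleton.1 ha
      exact ⟨_, List.prefix_rfl, .step h hp htr hl⟩

/-- A repeated state would have two traces of different lengths, against `unique`. Hence a trace is
no longer than the number of nodes, and the fuel `t.nodes.card` in `branch` suffices. -/
theorem nodup (h : Traces M t r q l) : l.Nodup := by
  induction h with
  | root => simp
  | @step q a l h hp htr hl ih =>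
    have hq : q ∉ l := by
      intro hq
      obtain ⟨l', hl', ht⟩ := hl.exists_prefix hq
      have := ht.unique (.step h hp htr hl)
      have := hl'.length_le
      simp_all
    rw [List.nodup_append]
    refine ⟨ih, by simp, ?_⟩
    rintro x hx y hy rfl
    exact hq (List.mem_singleton.1 hy ▸ hx)

theorem length_le_card (h : Traces M t r q l) : l.length ≤ t.nodes.card := by
  classical
  rw [← List.toFinset_card_of_nodup h.nodup]
  exact Finset.card_le_card fun b hb => h.subset b (List.mem_toFinset.1 hb)

theorem length_pos (h : Traces M t r q l) : 0 < l.length := by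
  cases h <;> simp

theorem traceBack_eq (h : Traces M t r q l) {n : ℕ} (hn : l.length ≤ n + 1) :
    traceBack t.parent n q = l := by
  induction h generalizing n with
  | root _ hp => cases n <;> simp [traceBack, hp]
  | step _ hp _ hl ih =>
    have := hl.length_pos
    cases n with
    | zero => simp at hn; simp [hn] at this
    | succ n =>
      simp only [traceBack, hp]
      rw [ih (by simpa using hn)]

theorem branch_eq (h : Traces M t r q l) : t.branch q = l :=
  h.traceBack_eq (h.length_le_card.trans (Nat.le_succ _))

theorem cost_eq [Fintype ι] (h : Traces M t r q l) : t.cost M q = M.pathCost l := by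
  rw [cost, h.branch_eq]

/-- Weights are nonnegative. This monotonicity is what excludes cycles in `Valid.reparent`. -/
theorem cost_le [Fintype ι] (h : Traces M t r q l) (ha : a ∈ l) : t.cost M a ≤ t.cost M q := by
  induction h with
  | root => rw [List.mem_singleton.1 ha]
  | step h hp htr hl ih =>
    rcases List.mem_append.1 ha with ha | ha
    · refine (ih ha).trans ?_
      rw [hl.cost_eq, (Traces.step h hp htr hl).cost_eq, M.pathCost_concat hl.getLast?]
      exact le_self_add
    · rw [List.mem_singleton.1 ha]

end Traces

variable [Fintype ι]

/-- The tree is rooted at `r`, its branches are paths of the product automaton, and no successor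
of the root costs more than the transition from the root. -/
structure Valid (M : Model ι R QB) (r : PState ι R QB) (t : Tree ι R QB) : Prop where
  root_mem : r ∈ t.nodes
  root_parent : t.parent r = none
  traces : ∀ q ∈ t.nodes, ∃ l, Traces M t r q l
  cost_le_weight : ∀ q ∈ t.nodes, M.trans r q → t.cost M q ≤ M.weight r q

/-- The tree `s` has all nodes of `t`, at no higher cost. -/
structure Improves (M : Model ι R QB) (t s : Tree ι R QB) : Prop where
  subset : t.nodes ⊆ s.nodes
  cost_le : ∀ q ∈ t.nodes, s.cost M q ≤ t.cost M q

theorem Improves.refl (t : Tree ι R QB) : Improves M t t := ⟨subset_rfl, fun _ _ => le_rfl⟩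

theorem Improves.trans {u : Tree ι R QB} (h : Improves M t s) (h' : Improves M s u) :
    Improves M t u :=
  ⟨h.subset.trans h'.subset,
    fun q hq => (h'.cost_le q (h.subset hq)).trans (h.cost_le q hq)⟩

namespace Valid

theorem cost_root (h : Valid M r t) : t.cost M r = 0 := by
  rw [(Traces.root h.root_mem h.root_parent).cost_eq]; rfl

theorem isPath_branch (h : Valid M r t) (hq : q ∈ t.nodes) : M.IsPath r q (t.branch q) := by
  obtain ⟨l, hl⟩ := h.traces q hq
  rw [hl.branch_eq]
  exact hl.isPath

theorem single (M : Model ι R QB) (r : PState ι R QB) : Valid M r (Tree.single r) := by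
  have hr : Traces M (Tree.single r) r r [r] := .root (by simp [Tree.single]) rfl
  refine ⟨hr.mem, rfl, fun q hq => ?_, fun q hq _ => ?_⟩ <;>
  obtain rfl : q = r := by simpa [Tree.single] using hq
  · exact ⟨_, hr⟩
  · rw [hr.cost_eq]; exact zero_le

/-- Strictness of the improvement keeps the tree acyclic: were `a` on the branch of `q`, it would
cost no more than `q`. It also protects the root, whose cost is `0`. -/
theorem reparent [DecidableEq (PState ι R QB)] (h : Valid M r t) (hq : q ∈ t.nodes)
    (htr : M.trans q a) (ha : a ∈ t.nodes)
    (hlt : t.cost M q + M.weight q a < t.cost M a) :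
    Valid M r ⟨t.nodes, Function.update t.parent a (some q)⟩ ∧
      Improves M t ⟨t.nodes, Function.update t.parent a (some q)⟩ ∧
      (⟨t.nodes, Function.update t.parent a (some q)⟩ : Tree ι R QB).cost M a ≤
        t.cost M q + M.weight q a := by
  set s : Tree ι R QB := ⟨t.nodes, Function.update t.parent a (some q)⟩ with hs
  have hpa : s.parent a = some q := by simp [hs]
  have hpb : ∀ b, b ≠ a → s.parent b = t.parent b := fun b hb => by simp [hs, hb]
  have har : r ≠ a := by
    rintro rfl
    rw [h.cost_root] at hlt
    exact not_lt_zero hlt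
  obtain ⟨l, hl⟩ := h.traces q hq
  have hal : a ∉ l := fun hal =>
    absurd (hlt.trans_le (hl.cost_le hal)) (not_lt.2 le_self_add)
  have key : ∀ {b l'}, Traces M t r b l' → a ∉ l' → Traces M s r b l' := by
    intro b l' hb
    induction hb with
    | root hm hp => exact fun _ => .root hm ((hpb _ har).trans hp)
    | step hm hp htr' _ ih =>
      intro hn
      simp only [List.mem_append, List.mem_singleton, not_or] at hn
      exact .step hm ((hpb _ (Ne.symm hn.2)).trans hp) htr' (ih hn.1)
  have hsa : Traces M s r a (l ++ [a]) := .step ha hpa htr (key hl hal)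
  have hca : s.cost M a = t.cost M q + M.weight q a := by
    rw [hsa.cost_eq, M.pathCost_concat hl.getLast?, hl.cost_eq]
  -- A trace through `a` has its piece up to `a` replaced by the cheaper new branch; other traces
  -- survive unchanged.
  have all : ∀ {b l'}, Traces M t r b l' → ∃ l'', Traces M s r b l'' ∧
      M.pathCost l'' ≤ M.pathCost l' := by
    intro b l' hb
    induction hb with
    | root hm hp => exact ⟨_, .root hm ((hpb _ har).trans hp), le_rfl⟩
    | @step b c l' hm hp htr' hb' ih =>
      by_cases hba : b = a
      · subst hba
        refine ⟨_, hsa, ?_⟩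
        rw [← hsa.cost_eq, hca, ← (Traces.step hm hp htr' hb').cost_eq]
        exact hlt.le
      · obtain ⟨l'', hl'', hc⟩ := ih
        refine ⟨_, .step hm ((hpb _ hba).trans hp) htr' hl'', ?_⟩
        rw [M.pathCost_concat hl''.getLast?, M.pathCost_concat hb'.getLast?]
        gcongr
  have himp : Improves M t s := by
    refine ⟨subset_rfl, fun b hb => ?_⟩
    obtain ⟨l', hl'⟩ := h.traces b hb
    obtain ⟨l'', hl'', hc⟩ := all hl'
    rwa [hl''.cost_eq, hl'.cost_eq]
  refine ⟨⟨h.root_mem, (hpb _ har).trans h.root_parent, fun b hb => ?_, fun b hb hrb =>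
    (himp.cost_le b hb).trans (h.cost_le_weight b hb hrb)⟩, himp, hca.le⟩
  obtain ⟨l', hl'⟩ := h.traces b hb
  obtain ⟨l'', hl'', _⟩ := all hl'
  exact ⟨l'', hl''⟩

/-- The new state is a leaf, so old traces and costs are untouched. If `r` has a transition to `q`,
then `r` is among the candidate parents, and minimality gives the bound by `M.weight r q`. -/
theorem extend (h : Valid M r t) (hq : q ∉ t.nodes) :
    Valid M r (t.extend M q) ∧ Improves M t (t.extend M q) ∧
      ((∃ a ∈ t.nodes, M.trans a q) → q ∈ (t.extend M q).nodes) := by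
  classical
  by_cases hne : (t.nodes.filter fun a => M.trans a q).Nonempty
  swap
  · have he : t.extend M q = t := by
      rw [Tree.extend, dif_neg]
      convert hne
    rw [he]
    refine ⟨h, .refl t, fun ⟨a, ha, htr⟩ => absurd ⟨a, ?_⟩ hne⟩
    exact Finset.mem_filter.2 ⟨ha, htr⟩
  · obtain ⟨a, ha, htr, hmin, he⟩ : ∃ a ∈ t.nodes, M.trans a q ∧
        (∀ a' ∈ t.nodes, M.trans a' q →
          t.cost M a + M.weight a q ≤ t.cost M a' + M.weight a' q) ∧
        t.extend M q = ⟨insert q t.nodes, Function.update t.parent q (some a)⟩ := by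
      have hne' : (@Finset.filter _ (fun a => M.trans a q)
          (fun _ => Classical.propDecidable _) t.nodes).Nonempty := by convert hne
      have hc := Classical.choose_spec (Finset.exists_min_image _
        (fun a => t.cost M a + M.weight a q) hne')
      refine ⟨_, (Finset.mem_filter.1 hc.1).1, (Finset.mem_filter.1 hc.1).2,
        fun a' ha' htr' => hc.2 a' (Finset.mem_filter.2 ⟨ha', htr'⟩), ?_⟩
      rw [Tree.extend, dif_pos hne']
    rw [he]
    set s : Tree ι R QB := ⟨insert q t.nodes, Function.update t.parent q (some a)⟩ with hs
    have hpq : s.parent q = some a := by simp [hs]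
    have hpb : ∀ b, b ≠ q → s.parent b = t.parent b := fun b hb => by simp [hs, hb]
    have hsub : t.nodes ⊆ s.nodes := Finset.subset_insert _ _
    have hrq : r ≠ q := fun hrq => hq (hrq ▸ h.root_mem)
    have key : ∀ {b l'}, Traces M t r b l' → Traces M s r b l' := by
      intro b l' hb
      induction hb with
      | root hm hp => exact .root (hsub hm) ((hpb _ hrq).trans hp)
      | step hm hp htr' _ ih =>
        exact .step (hsub hm) ((hpb _ fun hbq => hq (hbq ▸ hm)).trans hp) htr' ih
    have hcost : ∀ b ∈ t.nodes, s.cost M b = t.cost M b := by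
      intro b hb
      obtain ⟨l, hl⟩ := h.traces b hb
      rw [hl.cost_eq, (key hl).cost_eq]
    obtain ⟨l, hl⟩ := h.traces a ha
    have hsq : Traces M s r q (l ++ [q]) :=
      .step (Finset.mem_insert_self _ _) hpq htr (key hl)
    refine ⟨⟨hsub h.root_mem, (hpb _ hrq).trans h.root_parent, fun b hb => ?_,
      fun b hb hrb => ?_⟩, ⟨hsub, fun b hb => (hcost b hb).le⟩, fun _ => hsq.mem⟩
    · rcases Finset.mem_insert.1 hb with rfl | hb
      · exact ⟨_, hsq⟩
      · obtain ⟨l', hl'⟩ := h.traces b hb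
        exact ⟨l', key hl'⟩
    · rcases Finset.mem_insert.1 hb with rfl | hb
      · rw [hsq.cost_eq, M.pathCost_concat hl.getLast?, ← hl.cost_eq]
        refine (hmin r h.root_mem hrb).trans ?_
        rw [h.cost_root, zero_add]
      · rw [hcost b hb]
        exact h.cost_le_weight b hb hrb

theorem rewire (h : Valid M r t) (hq : q ∈ t.nodes) :
    Valid M r (t.rewire M q) ∧ Improves M t (t.rewire M q) ∧
      ∀ a ∈ t.nodes, M.trans q a → (t.rewire M q).cost M a ≤ t.cost M q + M.weight q a := by
  classical
  -- The starting tree is generalized because the cost of `q` may itself fall during the loop; a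
  -- bound in terms of its initial cost remains valid.
  have fold : ∀ (L : List (PState ι R QB)) (s : Tree ι R QB), Valid M r s → q ∈ s.nodes →
      (∀ a ∈ L, a ∈ s.nodes ∧ M.trans q a) →
      let u := L.foldl (fun s a =>
        if s.cost M q + M.weight q a < s.cost M a then
          ⟨s.nodes, Function.update s.parent a (some q)⟩
        else s) s
      Valid M r u ∧ Improves M s u ∧ ∀ a ∈ L, u.cost M a ≤ s.cost M q + M.weight q a := by
    intro L
    induction L with
    | nil => exact fun s hs _ _ => ⟨hs, .refl s, by simp⟩
    | cons a L ih =>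
      intro s hs hqs hL
      obtain ⟨ha, htr⟩ := hL a (by simp)
      simp only [List.foldl_cons]
      obtain ⟨s', hs', hval, himp, hca⟩ : ∃ s' : Tree ι R QB,
          (if s.cost M q + M.weight q a < s.cost M a then
            ⟨s.nodes, Function.update s.parent a (some q)⟩ else s) = s' ∧ Valid M r s' ∧
          Improves M s s' ∧ s'.cost M a ≤ s.cost M q + M.weight q a := by
        split_ifs with hlt
        · exact ⟨_, rfl, hs.reparent hqs htr ha hlt⟩
        · exact ⟨_, rfl, hs, .refl s, not_lt.1 hlt⟩
      rw [hs']
      obtain ⟨hv, hi, hc⟩ := ih s' hval (himp.subset hqs) fun b hb =>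
        ⟨himp.subset (hL b (by simp [hb])).1, (hL b (by simp [hb])).2⟩
      refine ⟨hv, himp.trans hi, fun b hb => ?_⟩
      rcases List.mem_cons.1 hb with rfl | hb
      · exact (hi.cost_le _ (himp.subset ha)).trans hca
      · refine (hc b hb).trans ?_
        gcongr
        exact himp.cost_le q hqs
  have := fold (t.nodes.filter fun a => M.trans q a).toList t h hq
    fun a ha => Finset.mem_filter.1 (Finset.mem_toList.1 ha)
  have hu : t.rewire M q = (t.nodes.filter fun a => M.trans q a).toList.foldl (fun s a =>
        if s.cost M q + M.weight q a < s.cost M a then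
          ⟨s.nodes, Function.update s.parent a (some q)⟩
        else s) t := by
    rw [Tree.rewire]
  rw [hu]
  exact ⟨this.1, this.2.1, fun a ha htr => this.2.2 a (Finset.mem_toList.2
    (Finset.mem_filter.2 ⟨ha, htr⟩))⟩

theorem process (h : Valid M r t) (q : PState ι R QB) :
    Valid M r (t.process M q) ∧ Improves M t (t.process M q) ∧
      ((∃ a ∈ t.nodes, M.trans a q) → q ∈ (t.process M q).nodes) ∧
      (q ∈ t.nodes → ∀ a ∈ t.nodes, M.trans q a →
        (t.process M q).cost M a ≤ t.cost M q + M.weight q a) := by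
  by_cases hq : q ∈ t.nodes
  · have he : t.process M q = t.rewire M q := by simp [Tree.process, hq]
    rw [he]
    obtain ⟨hv, hi, hc⟩ := h.rewire hq
    exact ⟨hv, hi, fun _ => hi.subset hq, fun _ => hc⟩
  · obtain ⟨hv, hi, hm⟩ := h.extend hq
    by_cases hq' : q ∈ (t.extend M q).nodes
    · have he : t.process M q = (t.extend M q).rewire M q := by simp [Tree.process, hq, hq']
      rw [he]
      obtain ⟨hv', hi', _⟩ := hv.rewire hq'
      exact ⟨hv', hi.trans hi', fun _ => hi'.subset hq', fun hc => absurd hc hq⟩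
    · have he : t.process M q = t.extend M q := by simp [Tree.process, hq, hq']
      rw [he]
      exact ⟨hv, hi, hm, fun hc => absurd hc hq⟩

theorem foldl_process (x : ι → R) (L : List QB) (h : Valid M r t) :
    let s := L.foldl (fun s b => s.process M (x, b)) t
    Valid M r s ∧ Improves M t s ∧ ∀ b ∈ L,
      ((∃ a ∈ t.nodes, M.trans a (x, b)) → (x, b) ∈ s.nodes) ∧
      ((x, b) ∈ t.nodes → ∀ a ∈ t.nodes, M.trans (x, b) a →
        s.cost M a ≤ t.cost M (x, b) + M.weight (x, b) a) := by
  induction L generalizing t with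
  | nil => exact ⟨h, .refl t, by simp⟩
  | cons c L ih =>
    obtain ⟨hv, hi, hm, hc⟩ := h.process (x, c)
    obtain ⟨hv', hi', hb⟩ := ih hv
    refine ⟨hv', hi.trans hi', fun b hbL => ?_⟩
    rcases List.mem_cons.1 hbL with rfl | hbL
    · exact ⟨fun he => hi'.subset (hm he), fun hq a ha htr =>
        (hi'.cost_le a (hi.subset ha)).trans (hc hq a ha htr)⟩
    · refine ⟨fun ⟨a, ha, htr⟩ => (hb b hbL).1 ⟨a, hi.subset ha, htr⟩, fun hq a ha htr => ?_⟩
      refine ((hb b hbL).2 (hi.subset hq) a (hi.subset ha) htr).trans ?_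
      gcongr
      exact hi.cost_le _ hq

variable [Fintype QB]

theorem step (h : Valid M r t) (o : Option (ι → R)) :
    Valid M r (t.step M o) ∧ Improves M t (t.step M o) := by
  cases o with
  | none => exact ⟨h, .refl t⟩
  | some x =>
    have := h.foldl_process x (Finset.univ : Finset QB).toList
    exact ⟨this.1, this.2.1⟩

/-- A sample treats all pairs `(q.1, b)`, hence also `q`; the other pairs, in whatever order, only
add nodes and lower costs. -/
theorem mem_step (h : Valid M r t) (ha : a ∈ t.nodes) (htr : M.trans a q) :
    q ∈ (t.step M (some q.1)).nodes :=
  ((h.foldl_process q.1 (Finset.univ : Finset QB).toList).2.2 q.2 (by simp)).1 ⟨a, ha, htr⟩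

theorem cost_step_le (h : Valid M r t) (hq : q ∈ t.nodes) (ha : a ∈ t.nodes)
    (htr : M.trans q a) :
    (t.step M (some q.1)).cost M a ≤ t.cost M q + M.weight q a :=
  ((h.foldl_process q.1 (Finset.univ : Finset QB).toList).2.2 q.2 (by simp)).2 hq a ha htr

end Valid

end Tree

end TreeTheory

end Stylus

namespace Stylus

/-! ### From ordered samples to a branch of optimal cost. -/

section Detection

variable {ι R QB : Type*}

/-- A cheaper competitor could replace the part in the plan, and the positive coefficient cancels.
For a suffix, the competitor is closed to a cycle by the transition with which the optimal cycle
returns from `g` to `f`. -/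
theorem Model.IsOptimalPart.isPath_and_le [Fintype ι] {M : Model ι R QB} {β : ℝ}
    {p : List (PState ι R QB)} (hp : M.IsOptimalPart β p) {r g : PState ι R QB}
    (hr : p.head? = some r) (hg : p.getLast? = some g) :
    M.IsPath r g p ∧ ∀ p', M.IsPath r g p' → M.pathCost p ≤ M.pathCost p' := by
  rcases hp with ⟨hβ, cyc, ⟨q₀, hq₀, f, hf, hpre, hcyc, hlen⟩, hopt⟩ |
    ⟨hβ, pre, cyc, ⟨⟨q₀, hq₀, f, hf, hpre, hcyc, hlen⟩, hopt⟩, rfl⟩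
  · obtain rfl : q₀ = r := Option.some.inj (hpre.head.symm.trans hr)
    obtain rfl : f = g := Option.some.inj (hpre.last.symm.trans hg)
    refine ⟨hpre, fun p' hp' => ?_⟩
    have := hopt p' cyc ⟨q₀, hq₀, f, hf, hp', hcyc, hlen⟩
    simp only [planCost] at this
    have h2 := le_of_mul_le_mul_left (le_of_add_le_add_right this) hβ
    exact_mod_cast h2
  · have hcl : cyc.dropLast ++ [f] = cyc :=
      List.dropLast_append_getLast? f hcyc.last
    obtain rfl : f = r := by
      have := hcyc.head
      rw [← hcl, List.head?_append, hr] at this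
      exact (Option.some.inj this).symm
    have hch := hcyc.chain
    rw [← hcl, List.isChain_append] at hch
    have hgf : M.trans g f := hch.2.2 g hg f rfl
    refine ⟨⟨hr, hg, hch.1⟩, fun p' hp' => ?_⟩
    have hlen' : 2 ≤ (p' ++ [f]).length := by
      have : p' ≠ [] := by rintro rfl; simpa using hp'.head
      have := List.length_pos_of_ne_nil this
      simp; omega
    have := hopt pre (p' ++ [f]) ⟨q₀, hq₀, f, hf, hpre, ⟨?_, ?_, ?_⟩, hlen'⟩
    · simp only [planCost] at this
      have h2 := le_of_mul_le_mul_left (le_of_add_le_add_left this) (sub_pos.2 hβ)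
      have h3 : M.pathCost cyc ≤ M.pathCost (p' ++ [f]) := by exact_mod_cast h2
      rw [← hcl, M.pathCost_concat hg, M.pathCost_concat hp'.last] at h3
      exact le_of_add_le_add_right h3
    · rw [List.head?_append, hp'.head]; rfl
    · simp
    · refine hp'.chain.append (List.isChain_singleton _) ?_
      intro x hx y hy
      rw [hp'.last] at hx
      simp only [Option.mem_def, Option.some.injEq, List.head?_cons] at hx hy
      subst hx hy
      exact hgf

namespace History

theorem past_cons (x : Option (ι → R)) (h : History ι R) {m : ℕ} (hm : m ≤ h.length) :
    past (x :: h) m = past h m := by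
  unfold past
  rw [List.length_cons, Nat.succ_sub hm, List.drop_succ_cons]

theorem past_self (h : History ι R) {m : ℕ} (hm : h.length ≤ m) : past h m = h := by
  unfold past
  rw [Nat.sub_eq_zero_of_le hm, List.drop_zero]

theorem length_past (h : History ι R) {m : ℕ} (hm : m ≤ h.length) : (past h m).length = m := by
  unfold past
  rw [List.length_drop]; omega

theorem past_past (h : History ι R) {m n : ℕ} (hnm : n ≤ m) :
    past (past h m) n = past h n := by
  unfold past
  rw [List.drop_drop, List.length_drop]
  congr 1
  omega

theorem past_succ (h : History ι R) {m : ℕ} (hm : m < h.length) :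
    ∃ x, past h (m + 1) = x :: past h m := by
  refine ⟨h[h.length - (m + 1)], ?_⟩
  unfold past
  rw [List.drop_eq_getElem_cons (by omega)]
  congr 2
  omega

variable [Fintype ι] [Fintype QB] {M : Model ι R QB} {r : PState ι R QB}

theorem tree_valid (M : Model ι R QB) (r : PState ι R QB) (h : History ι R) :
    (h.tree M r).Valid M r := by
  induction h with
  | nil => exact .single M r
  | cons x h ih => exact (ih.step x).1

theorem improves_cons (x : Option (ι → R)) (h : History ι R) :
    Tree.Improves M (h.tree M r) (History.tree M r (x :: h)) :=
  ((tree_valid M r h).step x).2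

theorem improves_past (h : History ι R) {m n : ℕ} (hmn : m ≤ n) (hn : n ≤ h.length) :
    Tree.Improves M ((h.past m).tree M r) ((h.past n).tree M r) := by
  induction n, hmn using Nat.le_induction with
  | base => exact .refl _
  | succ n _ ih =>
    obtain ⟨x, hx⟩ := h.past_succ hn
    rw [hx]
    exact (ih (by omega)).trans (improves_cons x _)

end History

namespace Sampler

variable [Fintype ι] [Fintype QB] {M : Model ι R QB} {r g : PState ι R QB} (S : Sampler M r)
  {p : List (PState ι R QB)}

theorem pathState_one (hr : p.head? = some r) : S.pathState p 1 = r := by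
  cases p <;> simp_all [pathState]

theorem pathState_succ {k : ℕ} (hk : k < p.length) : S.pathState p (k + 1) = p[k] := by
  simp [pathState, hk]

theorem pathState_mem {k : ℕ} (hk : 1 ≤ k) (hk' : k ≤ p.length) : S.pathState p k ∈ p := by
  obtain ⟨j, rfl⟩ := Nat.exists_eq_add_of_le' hk
  rw [S.pathState_succ hk']
  exact List.getElem_mem _

theorem exists_pathState {q : PState ι R QB} (hq : q ∈ p) :
    ∃ k, 1 ≤ k ∧ k ≤ p.length ∧ S.pathState p k = q := by
  obtain ⟨j, hj, rfl⟩ := List.mem_iff_getElem.1 hq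
  exact ⟨j + 1, by omega, hj, S.pathState_succ hj⟩

theorem trans_pathState (hch : p.IsChain M.trans) {k : ℕ} (hk : 1 ≤ k) (hk' : k < p.length) :
    M.trans (S.pathState p k) (S.pathState p (k + 1)) := by
  obtain ⟨j, rfl⟩ := Nat.exists_eq_add_of_le' hk
  rw [S.pathState_succ (by omega), S.pathState_succ hk']
  exact List.isChain_iff_getElem.1 hch j hk'

theorem pathCost_take_succ {k : ℕ} (hk : 1 ≤ k) (hk' : k < p.length) :
    M.pathCost (p.take (k + 1)) =
      M.pathCost (p.take k) + M.weight (S.pathState p k) (S.pathState p (k + 1)) := by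
  obtain ⟨j, rfl⟩ := Nat.exists_eq_add_of_le' hk
  rw [S.pathState_succ (by omega), S.pathState_succ hk', List.take_succ_eq_append_getElem hk',
    M.pathCost_concat]
  rw [List.take_succ_eq_append_getElem (by omega)]
  exact List.getLast?_concat

/-- The value `nmax + 1` keeps the set under the infimum nonempty and means "never", so smaller
values are genuine sampling times. -/
theorem selTime_le_iff {nbar nmax : ℕ} {h : History ι R} {k : ℕ} :
    S.selTime p nbar nmax h (k + 2) ≤ nmax ↔
      ∃ n, S.selTime p nbar nmax h (k + 1) < n ∧ n ≤ nmax ∧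
        (h.past n).head? = some (some (S.pathState p (k + 2)).1) := by
  rw [selTime]
  constructor
  · intro hle
    have := Nat.sInf_mem (s := {n | S.selTime p nbar nmax h (k + 1) < n ∧ n ≤ nmax ∧
      (h.past n).head? = some (some (S.pathState p (k + 2)).1)} ∪ {nmax + 1})
      ⟨nmax + 1, Or.inr rfl⟩
    rcases this with hm | hm
    · exact ⟨_, hm⟩
    · rw [hm] at hle; omega
  · rintro ⟨n, hn⟩
    exact (Nat.sInf_le (Or.inl hn)).trans hn.2.1

theorem selTime_spec {nbar nmax : ℕ} {h : History ι R} {k : ℕ}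
    (hk : S.selTime p nbar nmax h (k + 2) ≤ nmax) :
    S.selTime p nbar nmax h (k + 1) < S.selTime p nbar nmax h (k + 2) ∧
      (h.past (S.selTime p nbar nmax h (k + 2))).head? =
        some (some (S.pathState p (k + 2)).1) := by
  have := Nat.sInf_mem (s := {n | S.selTime p nbar nmax h (k + 1) < n ∧ n ≤ nmax ∧
      (h.past n).head? = some (some (S.pathState p (k + 2)).1)} ∪ {nmax + 1})
      ⟨nmax + 1, Or.inr rfl⟩
  rcases this with hm | hm
  · exact ⟨hm.1, hm.2.2⟩
  · have : S.selTime p nbar nmax h (k + 2) = nmax + 1 := hm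
    omega

theorem selTime_mono {nbar nmax : ℕ} {h : History ι R} {k : ℕ}
    (hk : S.selTime p nbar nmax h (k + 1) ≤ nmax) :
    S.selTime p nbar nmax h k < S.selTime p nbar nmax h (k + 1) := by
  cases k with
  | zero => exact Nat.lt_succ_self nbar
  | succ k => exact (S.selTime_spec hk).1

theorem lt_selTime {nbar nmax : ℕ} {h : History ι R} {k : ℕ}
    (hk : S.selTime p nbar nmax h (k + 1) ≤ nmax) :
    nbar < S.selTime p nbar nmax h (k + 1) := by
  induction k with
  | zero => exact Nat.lt_succ_self nbar
  | succ k ih =>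
    have := S.selTime_mono hk
    exact (ih (by omega)).trans this

/-- Whether the iteration `n_k` is at most `nmax`, and which one it is, is known by then. -/
theorem selTime_congr {nbar nmax m : ℕ} {h h' : History ι R} {k : ℕ} (hm : m ≤ nmax)
    (hk : S.selTime p nbar nmax h k = m) (hh : h.past m = h'.past m) :
    S.selTime p nbar nmax h' k = m := by
  match k with
  | 0 => exact hk
  | 1 => exact hk
  | k + 2 =>
    have hspec := S.selTime_spec (hk.le.trans hm)
    rw [hk] at hspec
    have hpast : ∀ n ≤ m, h.past n = h'.past n := fun n hn => by
      rw [← h.past_past hn, hh, h'.past_past hn]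
    have ih : S.selTime p nbar nmax h' (k + 1) = S.selTime p nbar nmax h (k + 1) :=
      selTime_congr (hspec.1.le.trans hm) rfl (hpast _ hspec.1.le)
    have hle : S.selTime p nbar nmax h' (k + 2) ≤ m := by
      refine Nat.sInf_le (Or.inl ⟨by rw [ih]; exact hspec.1, hm, ?_⟩)
      rw [← hh]
      exact hspec.2
    have hspec' := S.selTime_spec (hle.trans hm)
    refine le_antisymm hle ?_
    rw [← hk]
    refine Nat.sInf_le (Or.inl ⟨by rw [← ih]; exact hspec'.1, hle.trans hm, ?_⟩)
    rw [hpast _ hle]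
    exact hspec'.2

/-- Induction along `p`: the base is the invariant on successors of the root, and each selection
time passes the bound on by one rewiring. -/
theorem cost_pathState_le (hch : p.IsChain M.trans) (hr : p.head? = some r)
    {nbar nmax : ℕ} {h : History ι R} (hlen : h.length = nmax)
    (hA : h ∈ S.allAdded p nbar) {k : ℕ} (hk : k + 2 ≤ p.length)
    (hsel : S.selTime p nbar nmax h (k + 1) ≤ nmax) {m : ℕ}
    (hm : S.selTime p nbar nmax h (k + 1) ≤ m) (hm' : m ≤ nmax) :
    ((h.past m).tree M r).cost M (S.pathState p (k + 2)) ≤ M.pathCost (p.take (k + 2)) := by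
  have hadd : ∀ n, nbar ≤ n → n ≤ nmax → ∀ j, 1 ≤ j → j ≤ p.length →
      S.pathState p j ∈ ((h.past n).tree M r).nodes := fun n hn hn' j hj hj' =>
    (History.improves_past h hn (hn'.trans hlen.ge)).subset (hA _ (S.pathState_mem hj hj'))
  induction k generalizing m with
  | zero =>
    have htr := S.trans_pathState hch le_rfl hk
    rw [S.pathCost_take_succ le_rfl hk]
    rw [S.pathState_one hr] at htr ⊢
    have hm'' : nbar + 1 ≤ m := hm
    exact ((History.tree_valid M r _).cost_le_weight _
      (hadd m (by omega) hm' 2 (by omega) hk) htr).trans le_add_self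
  | succ k ih =>
    obtain ⟨hlt, hhead⟩ := S.selTime_spec hsel
    have hnb := S.lt_selTime hsel
    -- The rewiring in iteration `n + 1` uses costs after `n` iterations. Since selection times
    -- increase strictly, `n` is not before the previous one and the induction hypothesis applies.
    obtain ⟨n, hn⟩ : ∃ n, S.selTime p nbar nmax h (k + 2) = n + 1 :=
      Nat.exists_eq_add_of_le' (by omega)
    change S.selTime p nbar nmax h (k + 2) ≤ m at hm
    change S.selTime p nbar nmax h (k + 2) ≤ nmax at hsel
    change nbar < S.selTime p nbar nmax h (k + 2) at hnb
    rw [hn] at hlt hhead hm hsel hnb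
    obtain ⟨x, hx⟩ := h.past_succ (show n < h.length by omega)
    rw [hx] at hhead
    obtain rfl : x = some (S.pathState p (k + 2)).1 := by simpa using hhead
    have h1 := ih (by omega) (m := n) (by omega) (by omega) (by omega)
    have h2 := (History.tree_valid M r (h.past n)).cost_step_le
      (hadd n (by omega) (by omega) (k + 2) (by omega) (by omega))
      (hadd n (by omega) (by omega) (k + 3) (by omega) (by omega))
      (S.trans_pathState hch (show 1 ≤ k + 2 by omega) (by omega))
    have h3 := (History.improves_past (M := M) (r := r) h hm (by omega)).cost_le
      (S.pathState p (k + 3)) (hadd (n + 1) (by omega) (by omega) (k + 3) (by omega) (by omega))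
    rw [hx] at h3
    refine (h3.trans h2).trans ?_
    rw [S.pathCost_take_succ (show 1 ≤ k + 2 by omega) (by omega)]
    gcongr

theorem cost_le_of_selTime_le (hp : M.IsPath r g p)
    {nbar nmax : ℕ} {h : History ι R} (hlen : h.length = nmax)
    (hA : h ∈ S.allAdded p nbar) (hnbar : nbar ≤ nmax)
    (hsel : S.selTime p nbar nmax h (p.length - 1) ≤ nmax) :
    g ∈ (h.tree M r).nodes ∧ (h.tree M r).cost M g ≤ M.pathCost p := by
  have hpast : h.past nmax = h := h.past_self hlen.le
  have hgp : g ∈ p := List.mem_of_getLast? hp.last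
  have hmem : g ∈ (h.tree M r).nodes := by
    have := (History.improves_past (M := M) (r := r) h hnbar hlen.ge).subset (hA g hgp)
    rwa [hpast] at this
  refine ⟨hmem, ?_⟩
  match hK : p.length with
  | 0 => rw [List.length_eq_zero_iff.1 hK] at hgp; simp at hgp
  -- Here `p.length - 1 = 0` and no selection is involved: `g` is the root.
  | 1 =>
    obtain ⟨a, rfl⟩ := List.length_eq_one_iff.1 hK
    obtain rfl : a = r := by simpa using hp.head
    obtain rfl : a = g := by simpa using hp.last
    rw [(History.tree_valid M a h).cost_root]
    exact zero_le
  | K + 2 =>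
    rw [hK] at hsel
    have := S.cost_pathState_le hp.chain hp.head hlen hA hK.ge hsel hsel le_rfl
    rw [hpast, List.take_of_length_le hK.le, S.pathState_succ (by omega)] at this
    convert this
    have hl := hp.last
    rw [List.getLast?_eq_getElem?, hK] at hl
    simpa [hK] using hl.symm

theorem detects_of_cost_le {h : History ι R}
    (hopt : ∀ p', M.IsPath r g p' → M.pathCost p ≤ M.pathCost p')
    (hg : g ∈ (h.tree M r).nodes) (hc : (h.tree M r).cost M g ≤ M.pathCost p) :
    h ∈ S.detects p g := by
  have hpath := (History.tree_valid M r h).isPath_branch hg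
  exact ⟨hg, hpath, le_antisymm hc (hopt _ hpath)⟩

end Sampler

end Detection

end Stylus

namespace Stylus

/-! ### Expectations over runs and the two exponential estimates. -/

section Sampling

/-- If an event has probability at least `a`, then the mean of a variable that is `c ≤ 1` on the
event and `1` elsewhere is at most `exp (-a (1 - c))`. -/
theorem tsum_mul_ite_le_exp {α : Type*} (μ : PMF α) (P : α → Prop) [DecidablePred P] {a c : ℝ}
    (hc₀ : 0 ≤ c) (hc₁ : c ≤ 1) (ha₀ : 0 ≤ a)
    (ha : ENNReal.ofReal a ≤ ∑' x, μ x * (if P x then 1 else 0)) :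
    ∑' x, μ x * (if P x then ENNReal.ofReal c else 1) ≤
      ENNReal.ofReal (Real.exp (-(a * (1 - c)))) := by
  have hc : ENNReal.ofReal c + ENNReal.ofReal (1 - c) = 1 := by
    rw [← ENNReal.ofReal_add hc₀ (sub_nonneg.2 hc₁)]; simp
  -- The mean is `1 - (1 - c) * μ P`, written as a sum because subtraction truncates in `ℝ≥0∞`.
  have hsum : ∑' x, μ x * (if P x then ENNReal.ofReal c else 1) +
      ENNReal.ofReal (1 - c) * ∑' x, μ x * (if P x then 1 else 0) = 1 := by
    rw [← ENNReal.tsum_mul_left, ← ENNReal.tsum_add]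
    refine (tsum_congr fun x => ?_).trans μ.tsum_coe
    split_ifs
    · rw [mul_one, mul_comm (ENNReal.ofReal (1 - c)), ← mul_add, hc, mul_one]
    · simp
  have hle : ENNReal.ofReal (a * (1 - c)) ≤
      ENNReal.ofReal (1 - c) * ∑' x, μ x * (if P x then 1 else 0) := by
    rw [ENNReal.ofReal_mul ha₀, mul_comm]
    gcongr
  have h1 : ∑' x, μ x * (if P x then ENNReal.ofReal c else 1) ≤
      1 - ENNReal.ofReal (a * (1 - c)) := by
    refine ENNReal.le_sub_of_add_le_right ENNReal.ofReal_ne_top ?_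
    refine le_of_le_of_eq ?_ hsum
    gcongr
  refine h1.trans ?_
  rw [← ENNReal.ofReal_one, ← ENNReal.ofReal_sub _ (mul_nonneg ha₀ (sub_nonneg.2 hc₁))]
  refine ENNReal.ofReal_le_ofReal ?_
  have := Real.add_one_le_exp (-(a * (1 - c)))
  linarith

variable {ι R QB : Type*}

instance : DiscreteMeasurableSpace (History ι R) := ⟨fun _ => trivial⟩

namespace Sampler

variable [Fintype ι] [Fintype QB] {M : Model ι R QB} {r : PState ι R QB} (S : Sampler M r)
  {p : List (PState ι R QB)}

/-- Law of the sample taken after the history `h`. -/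
noncomputable def stepLaw (h : History ι R) : PMF (Option (ι → R)) := (S.rand h).bind (S.new h)

/-- Mean of a function of the history of the first `n` iterations. -/
noncomputable def expect (n : ℕ) (f : History ι R → ℝ≥0∞) : ℝ≥0∞ := ∑' h, S.runLaw n h * f h

theorem expect_zero (f : History ι R → ℝ≥0∞) : S.expect 0 f = f [] := by
  rw [expect, tsum_eq_single []]
  · simp [runLaw]
  · intro h hh
    simp [runLaw, hh]

theorem expect_succ (n : ℕ) (f : History ι R → ℝ≥0∞) :
    S.expect (n + 1) f = S.expect n fun h => ∑' x, S.stepLaw h x * f (x :: h) := by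
  have hmap : ∀ (μ : PMF (Option (ι → R))) (h : History ι R),
      ∑' h', (μ.map fun x => x :: h) h' * f h' = ∑' x, μ x * f (x :: h) := by
    intro μ h
    simp only [PMF.map_apply, ← ENNReal.tsum_mul_right]
    rw [ENNReal.tsum_comm]
    refine tsum_congr fun x => ?_
    rw [tsum_eq_single (x :: h)]
    · simp
    · intro h' hh'
      simp [hh']
  simp only [expect, runLaw, PMF.bind_apply, ← ENNReal.tsum_mul_right]
  rw [ENNReal.tsum_comm]
  refine tsum_congr fun h => ?_
  simp only [mul_assoc, ENNReal.tsum_mul_left]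
  rw [hmap]
  rfl

theorem expect_mono {n : ℕ} {f g : History ι R → ℝ≥0∞}
    (hfg : ∀ h ∈ (S.runLaw n).support, f h ≤ g h) : S.expect n f ≤ S.expect n g := by
  refine ENNReal.tsum_le_tsum fun h => ?_
  by_cases hh : S.runLaw n h = 0
  · simp [hh]
  · gcongr
    exact hfg h ((PMF.mem_support_iff _ _).2 hh)

theorem expect_congr {n : ℕ} {f g : History ι R → ℝ≥0∞}
    (hfg : ∀ h ∈ (S.runLaw n).support, f h = g h) : S.expect n f = S.expect n g :=
  le_antisymm (S.expect_mono fun h hh => (hfg h hh).le) (S.expect_mono fun h hh => (hfg h hh).ge)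

theorem expect_const_mul (n : ℕ) (c : ℝ≥0∞) (f : History ι R → ℝ≥0∞) :
    S.expect n (fun h => c * f h) = c * S.expect n f := by
  simp only [expect, ← ENNReal.tsum_mul_left, mul_left_comm]

theorem runMeasure_apply (n : ℕ) (E : Set (History ι R)) :
    S.runMeasure n E = S.expect n (E.indicator 1) := by
  rw [runMeasure, PMF.toMeasure_apply _ (MeasurableSet.of_discrete), expect]
  refine tsum_congr fun h => ?_
  by_cases hh : h ∈ E <;> simp [hh]

instance (n : ℕ) : MeasureTheory.IsProbabilityMeasure (S.runMeasure n) :=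
  inferInstanceAs (MeasureTheory.IsProbabilityMeasure (S.runLaw n).toMeasure)

theorem length_of_mem_support {n : ℕ} {h : History ι R} (hh : h ∈ (S.runLaw n).support) :
    h.length = n := by
  induction n generalizing h with
  | zero =>
    obtain rfl : h = [] := by simpa [runLaw] using hh
    rfl
  | succ n ih =>
    obtain ⟨h', hh', x, _, rfl⟩ : ∃ h' ∈ (S.runLaw n).support, ∃ x ∈ (S.stepLaw h').support,
        x :: h' = h := by
      rw [runLaw, PMF.mem_support_bind_iff] at hh
      obtain ⟨h', hh', hx⟩ := hh
      rw [PMF.mem_support_map_iff] at hx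
      obtain ⟨x, hx, he⟩ := hx
      exact ⟨h', hh', x, hx, he⟩
    rw [List.length_cons, ih hh']

/-- Only finitely many histories have a given length. The infima in `alpha` and `gamma` are
therefore attained, which makes them positive. -/
theorem finite_support [Finite R] (n : ℕ) : (S.runLaw n).support.Finite :=
  (List.finite_length_eq (Option (ι → R)) n).subset fun _ hh => S.length_of_mem_support hh

/-- Only an inequality: the same sample may also come from nodes without a transition to `q`. -/
theorem ofReal_newProb_le (h : History ι R) (q : PState ι R QB) :
    ENNReal.ofReal (S.newProb h q) ≤ S.stepLaw h (some q.1) := by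
  classical
  rw [newProb, ENNReal.ofReal_sum_of_nonneg fun _ _ => by positivity, stepLaw, PMF.bind_apply]
  refine le_trans (Finset.sum_le_sum fun a _ => ?_) (ENNReal.sum_le_tsum _)
  rw [ENNReal.ofReal_mul ENNReal.toReal_nonneg, ENNReal.ofReal_toReal (PMF.apply_ne_top _ _),
    ENNReal.ofReal_toReal (PMF.apply_ne_top _ _)]

theorem newProb_nonneg (h : History ι R) (q : PState ι R QB) : 0 ≤ S.newProb h q :=
  Finset.sum_nonneg fun _ _ => by positivity

theorem newProb_le_one (h : History ι R) (q : PState ι R QB) : S.newProb h q ≤ 1 := by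
  have := (S.ofReal_newProb_le h q).trans (PMF.coe_le_one _ _)
  rwa [ENNReal.ofReal_le_one] at this

theorem newProb_pos {h : History ι R} {a q : PState ι R QB} (ha : a ∈ (h.tree M r).nodes)
    (htr : M.trans a q) : 0 < S.newProb h q := by
  classical
  refine Finset.sum_pos' (fun _ _ => by positivity) ⟨a, Finset.mem_filter.2 ⟨ha, htr⟩, ?_⟩
  have h1 : a ∈ (S.rand h).support := by rw [S.rand_support]; exact ha
  have h2 : some q.1 ∈ (S.new h a).support := (S.new_support h a ha q.1).2 htr.1
  exact mul_pos (ENNReal.toReal_pos ((PMF.mem_support_iff _ _).1 h1) (PMF.apply_ne_top _ _))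
    (ENNReal.toReal_pos ((PMF.mem_support_iff _ _).1 h2) (PMF.apply_ne_top _ _))

theorem pathIndex_spec (hr : p.head? = some r) (h : History ι R) :
    1 ≤ S.pathIndex p h ∧ S.pathIndex p h ≤ p.length ∧
      ∀ j, 1 ≤ j → j < S.pathIndex p h → S.pathState p j ∈ (h.tree M r).nodes := by
  have hpos : 1 ≤ p.length := by cases p <;> simp_all
  induction h with
  | nil => exact ⟨le_rfl, hpos, fun j hj hj' => absurd (hj.trans_lt hj') (lt_irrefl _)⟩
  | cons x h ih =>
    obtain ⟨h1, h2, h3⟩ := ih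
    have hsub := (History.improves_cons (M := M) (r := r) x h).subset
    rw [pathIndex]
    split_ifs with hmem
    · refine ⟨by omega, by omega, fun j hj hj' => ?_⟩
      rcases Nat.lt_or_ge j (S.pathIndex p h) with hlt | hge
      · exact hsub (h3 j hj hlt)
      · obtain rfl : j = S.pathIndex p h := by omega
        exact hmem
    · exact ⟨h1, h2, fun j hj hj' => hsub (h3 j hj hj')⟩

/-- The predecessor of the awaited state is already in the tree, and the densities are positive
there; for index `1` the awaited state is the root itself. -/
theorem addProb_mem_Ioc (hp : p.IsChain M.trans) (hr : p.head? = some r) (h : History ι R) :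
    S.addProb h (S.pathState p (S.pathIndex p h)) ∈ Set.Ioc (0 : ℝ) 1 := by
  rw [addProb]
  split_ifs with hmem
  · simp
  refine ⟨?_, S.newProb_le_one _ _⟩
  obtain ⟨h1, h2, h3⟩ := S.pathIndex_spec hr h
  obtain ⟨j, hj⟩ := Nat.exists_eq_add_of_le' h1
  rw [hj] at hmem h2 h3 ⊢
  rcases Nat.eq_zero_or_pos j with rfl | hj0
  · rw [zero_add, S.pathState_one hr] at hmem
    exact absurd (History.tree_valid M r h).root_mem hmem
  · exact S.newProb_pos (h3 j hj0 (by omega)) (S.trans_pathState hp hj0 (by omega))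

theorem alpha_le {n : ℕ} {h : History ι R} (hp : p.IsChain M.trans) (hr : p.head? = some r)
    (hh : h ∈ (S.runLaw (n - 1)).support) :
    S.alpha p n ≤ S.addProb h (S.pathState p (S.pathIndex p h)) :=
  csInf_le ⟨0, by rintro _ ⟨h', _, rfl⟩; exact (S.addProb_mem_Ioc hp hr h').1.le⟩ ⟨h, hh, rfl⟩

theorem alpha_mem_Ioc [Finite R] (hp : p.IsChain M.trans) (hr : p.head? = some r) (n : ℕ) :
    S.alpha p n ∈ Set.Ioc (0 : ℝ) 1 := by
  have hfin : {a | ∃ h ∈ (S.runLaw (n - 1)).support,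
      a = S.addProb h (S.pathState p (S.pathIndex p h))}.Finite := by
    refine ((S.finite_support (n - 1)).image
      fun h => S.addProb h (S.pathState p (S.pathIndex p h))).subset ?_
    rintro _ ⟨h, hh, rfl⟩
    exact ⟨h, hh, rfl⟩
  obtain ⟨h, hh⟩ := (S.runLaw (n - 1)).support_nonempty
  obtain ⟨h', _, he⟩ := Set.Nonempty.csInf_mem (s := {a | ∃ h ∈ (S.runLaw (n - 1)).support,
      a = S.addProb h (S.pathState p (S.pathIndex p h))}) ⟨_, h, hh, rfl⟩ hfin
  rw [alpha, he]
  exact S.addProb_mem_Ioc hp hr h'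

theorem gamma_le {n k : ℕ} {h : History ι R} (hk : 2 ≤ k) (hh : h ∈ (S.runLaw (n - 1)).support)
    (hall : ∀ q ∈ p, q ∈ (h.tree M r).nodes) :
    S.gamma p n k ≤ S.newProb h (S.pathState p k) := by
  have hmem : S.newProb h (S.pathState p k) ∈ S.newProbValues p n k := ⟨h, hh, hall, rfl⟩
  rw [gamma, if_pos ⟨hk, _, hmem⟩]
  exact csInf_le ⟨0, by rintro _ ⟨h', _, _, rfl⟩; exact S.newProb_nonneg _ _⟩ hmem

theorem gamma_mem_Ioc [Finite R] (hp : p.IsChain M.trans) (n : ℕ) {k : ℕ}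
    (hk : k ≤ p.length) : S.gamma p n k ∈ Set.Ioc (0 : ℝ) 1 := by
  rw [gamma]
  split_ifs with h
  swap
  · simp
  have hfin : (S.newProbValues p n k).Finite := by
    refine ((S.finite_support (n - 1)).image fun h => S.newProb h (S.pathState p k)).subset ?_
    rintro _ ⟨h, hh, _, rfl⟩
    exact ⟨h, hh, rfl⟩
  obtain ⟨h', _, hall, he⟩ := h.2.csInf_mem hfin
  rw [he]
  obtain ⟨j, rfl⟩ := Nat.exists_eq_add_of_le' h.1
  exact ⟨S.newProb_pos (hall _ (S.pathState_mem (show 1 ≤ j + 1 by omega) (by omega)))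
    (S.trans_pathState hp (by omega) (by omega)), S.newProb_le_one _ _⟩

/-- As long as some state of `p` is missing in the tree, `exp (K + 1 - k)` for the index `k` of
the state that is waited for. -/
noncomputable def potential (p : List (PState ι R QB)) (h : History ι R) : ℝ≥0∞ :=
  open Classical in
  if ∀ q ∈ p, q ∈ (h.tree M r).nodes then 0
  else ENNReal.ofReal (Real.exp ((p.length : ℝ) + 1 - S.pathIndex p h))

open Classical in
-- A success raises the index by one, which costs a factor `exp (-1)`. At index `K` it completes `p`
-- instead, and the potential drops to `0`.
theorem potential_cons_le (hr : p.head? = some r) (x : Option (ι → R)) (h : History ι R) :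
    S.potential p (x :: h) ≤ S.potential p h *
      if S.pathState p (S.pathIndex p h) ∈ (History.tree M r (x :: h)).nodes then
        ENNReal.ofReal (Real.exp (-1)) else 1 := by
  have hsub := (History.improves_cons (M := M) (r := r) x h).subset
  by_cases hall' : ∀ q ∈ p, q ∈ (History.tree M r (x :: h)).nodes
  · rw [potential, if_pos hall']; exact zero_le
  have hall : ¬ ∀ q ∈ p, q ∈ (h.tree M r).nodes := fun hall =>
    hall' fun q hq => hsub (hall q hq)
  rw [potential, if_neg hall', potential, if_neg hall]
  obtain ⟨h1, h2, h3⟩ := S.pathIndex_spec hr h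
  by_cases hmem : S.pathState p (S.pathIndex p h) ∈ (History.tree M r (x :: h)).nodes
  · rw [if_pos hmem, pathIndex, if_pos hmem, ← ENNReal.ofReal_mul (Real.exp_nonneg _),
      ← Real.exp_add]
    have hlt : S.pathIndex p h < p.length := by
      refine lt_of_le_of_ne h2 fun he => hall' fun q hq => ?_
      obtain ⟨j, hj, hj', rfl⟩ := S.exists_pathState hq
      rcases hj'.lt_or_eq with hlt | heq
      · exact hsub (h3 j hj (by omega))
      · rw [heq, ← he]; exact hmem
    rw [min_eq_left hlt]
    refine ENNReal.ofReal_le_ofReal (Real.exp_le_exp.2 ?_)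
    push_cast
    linarith
  · rw [if_neg hmem, pathIndex, if_neg hmem, mul_one]

open Classical in
theorem ofReal_addProb_le (h : History ι R) (q : PState ι R QB) :
    ENNReal.ofReal (S.addProb h q) ≤ ∑' x, S.stepLaw h x *
      if q ∈ (History.tree M r (x :: h)).nodes then 1 else 0 := by
  rw [addProb]
  split_ifs with hmem
  · refine le_of_eq_of_le (ENNReal.ofReal_one.trans (S.stepLaw h).tsum_coe.symm) ?_
    refine ENNReal.tsum_le_tsum fun x => ?_
    rw [if_pos ((History.improves_cons (M := M) (r := r) x h).subset hmem), mul_one]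
  · by_cases hex : ∃ a ∈ (h.tree M r).nodes, M.trans a q
    · obtain ⟨a, ha, htr⟩ := hex
      refine ((S.ofReal_newProb_le h q).trans ?_).trans (ENNReal.le_tsum (some q.1))
      have : q ∈ (History.tree M r (some q.1 :: h)).nodes :=
        (History.tree_valid M r h).mem_step ha htr
      rw [if_pos this, mul_one]
    · have : S.newProb h q = 0 := by
        rw [newProb, Finset.filter_false_of_mem fun a ha htr => hex ⟨a, ha, htr⟩,
          Finset.sum_empty]
      rw [this, ENNReal.ofReal_zero]
      exact zero_le

/-- A supermartingale estimate. The initial index is `1`, so the potential starts at no more than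
`exp K`. -/
theorem expect_potential_le [Finite R] (hp : p.IsChain M.trans) (hr : p.head? = some r) (n : ℕ) :
    S.expect n (S.potential p) ≤ ENNReal.ofReal
      (Real.exp (-(∑ i ∈ Finset.Icc 1 n, S.alpha p i) / 2 + p.length)) := by
  classical
  induction n with
  | zero =>
    rw [expect_zero, potential]
    split_ifs
    · exact zero_le
    · simp [pathIndex]
  | succ n ih =>
    rw [expect_succ]
    have hstep : ∀ h ∈ (S.runLaw n).support,
        ∑' x, S.stepLaw h x * S.potential p (x :: h) ≤
          ENNReal.ofReal (Real.exp (-(S.alpha p (n + 1)) / 2)) * S.potential p h := by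
      intro h hh
      -- The factor `1 / 2` in the exponent originates here, from `1 - exp (-1) ≥ 1 / 2`.
      have hexp : Real.exp (-1) ≤ 1 / 2 := by
        rw [Real.exp_neg, one_div]
        refine inv_anti₀ two_pos ?_
        have := Real.add_one_le_exp 1
        linarith
      have hα := S.alpha_mem_Ioc hp hr (n + 1)
      have key := tsum_mul_ite_le_exp (S.stepLaw h)
        (fun x => S.pathState p (S.pathIndex p h) ∈ (History.tree M r (x :: h)).nodes)
        (Real.exp_nonneg (-1)) (by linarith) hα.1.le
        ((ENNReal.ofReal_le_ofReal (S.alpha_le hp hr hh)).trans (S.ofReal_addProb_le h _))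
      calc ∑' x, S.stepLaw h x * S.potential p (x :: h)
          ≤ ∑' x, S.potential p h * (S.stepLaw h x *
            if S.pathState p (S.pathIndex p h) ∈ (History.tree M r (x :: h)).nodes then
              ENNReal.ofReal (Real.exp (-1)) else 1) := by
            refine ENNReal.tsum_le_tsum fun x => ?_
            rw [mul_left_comm]
            gcongr
            exact S.potential_cons_le hr x h
        _ ≤ _ := by
            rw [ENNReal.tsum_mul_left, mul_comm]
            gcongr
            refine key.trans (ENNReal.ofReal_le_ofReal (Real.exp_le_exp.2 ?_))
            nlinarith [hα.1]
    refine (S.expect_mono hstep).trans ?_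
    rw [expect_const_mul]
    refine (mul_le_mul_right ih _).trans ?_
    rw [← ENNReal.ofReal_mul (Real.exp_nonneg _), ← Real.exp_add,
      Finset.sum_Icc_succ_top (by omega)]
    refine ENNReal.ofReal_le_ofReal (Real.exp_le_exp.2 ?_)
    linarith

theorem expect_past {m l : ℕ} (hml : m ≤ l) (f : History ι R → ℝ≥0∞) :
    S.expect l (fun h => f (h.past m)) = S.expect m f := by
  induction l, hml using Nat.le_induction with
  | base => exact S.expect_congr fun h hh => by rw [h.past_self (S.length_of_mem_support hh).le]
  | succ l hml ih =>
    rw [expect_succ, ← ih]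
    refine S.expect_congr fun h hh => ?_
    have : ∀ x, History.past (x :: h) m = h.past m := fun x =>
      h.past_cons x (hml.trans (S.length_of_mem_support hh).ge)
    simp only [this, ENNReal.tsum_mul_right, PMF.tsum_coe, one_mul]

/-- Markov's inequality: the index is at most `K`, so the potential is at least `1` while a state is
missing. -/
theorem tail_le_runMeasure_allAdded [Finite R] (hp : p.IsChain M.trans) (hr : p.head? = some r)
    {nbar nmax : ℕ} (hn : nbar ≤ nmax) :
    tail (∑ n ∈ Finset.Icc 1 nbar, S.alpha p n) p.length ≤
      (S.runMeasure nmax).real (S.allAdded p nbar) := by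
  classical
  have hcompl : S.runMeasure nmax (S.allAdded p nbar)ᶜ ≤ S.expect nbar (S.potential p) := by
    rw [runMeasure_apply, ← S.expect_past hn]
    refine S.expect_mono fun h _ => ?_
    by_cases hh : h ∈ S.allAdded p nbar
    · simp [hh]
    · rw [Set.indicator_of_mem hh, Pi.one_apply, potential,
        if_neg (show ¬ ∀ q ∈ p, q ∈ ((h.past nbar).tree M r).nodes from hh)]
      refine le_of_eq_of_le (by simp : (1 : ℝ≥0∞) = ENNReal.ofReal (Real.exp 0))
        (ENNReal.ofReal_le_ofReal (Real.exp_le_exp.2 ?_))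
      have := (S.pathIndex_spec hr (h.past nbar)).2.1
      have : (S.pathIndex p (h.past nbar) : ℝ) ≤ p.length := by exact_mod_cast this
      linarith
  have hreal : (S.runMeasure nmax).real (S.allAdded p nbar)ᶜ ≤
      Real.exp (-(∑ i ∈ Finset.Icc 1 nbar, S.alpha p i) / 2 + p.length) :=
    ENNReal.toReal_le_of_le_ofReal (Real.exp_nonneg _)
      (hcompl.trans (S.expect_potential_le hp hr nbar))
  rw [MeasureTheory.probReal_compl_eq_one_sub MeasurableSet.of_discrete] at hreal
  exact max_le MeasureTheory.measureReal_nonneg (by linarith)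

/-- Once all states of `p` are in the tree, the state `q^k` is rarely missed for long. -/
theorem expect_no_sample_le [Finite R] (hp : p.IsChain M.trans) {k m l : ℕ} (hk : 2 ≤ k)
    (hkp : k ≤ p.length) (hml : m ≤ l) {C : Set (History ι R)}
    (hC : ∀ h ∈ C, ∀ q ∈ p, q ∈ (h.tree M r).nodes) :
    S.expect l (Set.indicator {h | h.past m ∈ C ∧ ∀ n, m < n → n ≤ l →
      (h.past n).head? ≠ some (some (S.pathState p k).1)} 1) ≤
    ENNReal.ofReal (Real.exp (-∑ n ∈ Finset.Ioc m l, S.gamma p n k)) *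
      S.expect m (C.indicator 1) := by
  classical
  induction l, hml using Nat.le_induction with
  | base =>
    simp only [Finset.Ioc_self, Finset.sum_empty, neg_zero, Real.exp_zero, ENNReal.ofReal_one,
      one_mul]
    rw [← S.expect_past le_rfl (C.indicator 1)]
    refine S.expect_mono fun h _ => Set.indicator_le'
      (g := fun h => C.indicator 1 (h.past m)) (fun h hh => ?_) (fun _ _ => zero_le) h
    simp [hh.1]
  | succ l hml ih =>
    set E : ℕ → Set (History ι R) := fun l => {h | h.past m ∈ C ∧ ∀ n, m < n → n ≤ l →
      (h.past n).head? ≠ some (some (S.pathState p k).1)} with hE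
    have hstep : ∀ h ∈ (S.runLaw l).support,
        ∑' x, S.stepLaw h x * (E (l + 1)).indicator 1 (x :: h) ≤
          ENNReal.ofReal (Real.exp (-S.gamma p (l + 1) k)) * (E l).indicator 1 h := by
      intro h hh
      have hlen := S.length_of_mem_support hh
      have hmem : ∀ x, x :: h ∈ E (l + 1) → h ∈ E l ∧ x ≠ some (S.pathState p k).1 := by
        rintro x ⟨h1, h2⟩
        rw [h.past_cons x (by omega)] at h1
        refine ⟨⟨h1, fun n hn hn' => ?_⟩, ?_⟩
        · rw [← h.past_cons x (by omega)]
          exact h2 n hn (by omega)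
        · have := h2 (l + 1) (by omega) le_rfl
          rw [History.past_self _ (by simp [hlen])] at this
          simpa using this
      by_cases hEl : h ∈ E l
      · rw [Set.indicator_of_mem hEl, Pi.one_apply, mul_one]
        have hall : ∀ q ∈ p, q ∈ (h.tree M r).nodes := fun q hq => by
          have := (History.improves_past (M := M) (r := r) h hml hlen.ge).subset (hC _ hEl.1 q hq)
          rwa [h.past_self hlen.le] at this
        have hγ := (S.gamma_mem_Ioc hp (l + 1) hkp).1.le
        -- With the value `c = 0` on a hit, the mean is the probability of a miss.
        have key := tsum_mul_ite_le_exp (S.stepLaw h) (fun x => x = some (S.pathState p k).1)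
          le_rfl zero_le_one hγ (by
            refine ((ENNReal.ofReal_le_ofReal (S.gamma_le hk hh hall)).trans
              (S.ofReal_newProb_le h _)).trans ?_
            refine le_trans ?_ (ENNReal.le_tsum (some (S.pathState p k).1))
            simp)
        rw [sub_zero, mul_one] at key
        refine le_trans (ENNReal.tsum_le_tsum fun x => ?_) key
        gcongr
        split_ifs with hx
        · rw [Set.indicator_of_notMem fun hm => (hmem x hm).2 hx]
          exact zero_le
        · exact Set.indicator_le_self' (fun _ _ => zero_le) _
      · have : ∀ x, (E (l + 1)).indicator (1 : History ι R → ℝ≥0∞) (x :: h) = 0 := fun x =>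
          Set.indicator_of_notMem (fun hm => hEl (hmem x hm).1) _
        simp [this]
    rw [expect_succ]
    refine (S.expect_mono hstep).trans ?_
    rw [expect_const_mul]
    refine (mul_le_mul_right ih _).trans ?_
    rw [← mul_assoc, ← ENNReal.ofReal_mul (Real.exp_nonneg _), ← Real.exp_add,
      Finset.sum_Ioc_succ_top hml, neg_add, add_comm]

end Sampler

end Sampling

end Stylus

namespace Stylus

/-! ### Conditioning on the selection times and telescoping. -/

section Rate

variable {ι R QB : Type*}

namespace Sampler

variable [Fintype ι] [Fintype QB] {M : Model ι R QB} {r g : PState ι R QB} (S : Sampler M r)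
  {p : List (PState ι R QB)}

theorem tail_nonneg (s c : ℝ) : 0 ≤ tail s c := le_max_left _ _

theorem tail_le_one (s c : ℝ) : tail s c ≤ 1 :=
  max_le zero_le_one (by linarith [Real.exp_nonneg (-s / 2 + c)])

/-- The event that all states of `p` are in the tree after `nbar` iterations and that the
iteration `n_k` exists. -/
def reached (p : List (PState ι R QB)) (nbar nmax k : ℕ) : Set (History ι R) :=
  S.allAdded p nbar ∩ {h | S.selTime p nbar nmax h k ≤ nmax}

theorem mem_allAdded_past {nbar m : ℕ} (hm : nbar ≤ m) (h : History ι R) :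
    h.past m ∈ S.allAdded p nbar ↔ h ∈ S.allAdded p nbar := by
  rw [allAdded, Set.mem_ofPred_eq, Set.mem_ofPred_eq, h.past_past hm]

/-- The selection times act as stopping times: by `selTime_congr` the event at time `m` can be read
off `h.past m`, so the no-sample estimate applies from `m` on. -/
theorem real_missed_le [Finite R] (hp : p.IsChain M.trans) {nbar nmax m k : ℕ}
    (hk : k + 2 ≤ p.length) (hm : m ≤ nmax) (hnm : nbar ≤ m) :
    (S.runMeasure nmax).real {h | h ∈ S.allAdded p nbar ∧
      S.selTime p nbar nmax h (k + 1) = m ∧ ¬ S.selTime p nbar nmax h (k + 2) ≤ nmax} ≤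
    Real.exp (-∑ n ∈ Finset.Ioc m nmax, S.gamma p n (k + 2)) *
      (S.runMeasure nmax).real {h | h ∈ S.allAdded p nbar ∧
        S.selTime p nbar nmax h (k + 1) = m} := by
  have hpast : ∀ h : History ι R, h.past m ∈ S.allAdded p nbar ∧
      S.selTime p nbar nmax (h.past m) (k + 1) = m ↔
      h ∈ S.allAdded p nbar ∧ S.selTime p nbar nmax h (k + 1) = m := fun h => by
    rw [S.mem_allAdded_past hnm]
    exact and_congr_right fun _ => ⟨fun hs => S.selTime_congr hm hs (h.past_past le_rfl),
      fun hs => S.selTime_congr hm hs (h.past_past le_rfl).symm⟩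
  -- The condition on the length ensures that the first `nbar` iterations lie within `h`, so that
  -- their nodes are still in its tree.
  set C : Set (History ι R) := {h | (h ∈ S.allAdded p nbar ∧
    S.selTime p nbar nmax h (k + 1) = m) ∧ h.length = m} with hCdef
  have hC : ∀ h ∈ C, ∀ q ∈ p, q ∈ (h.tree M r).nodes := by
    rintro h ⟨⟨hA, _⟩, hlen⟩ q hq
    have := (History.improves_past (M := M) (r := r) h hnm hlen.ge).subset (hA q hq)
    rwa [h.past_self hlen.le] at this
  have hle := S.expect_no_sample_le hp (show 2 ≤ k + 2 by omega) hk hm hC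
  have hPC : S.expect m (C.indicator 1) = S.runMeasure nmax {h | h ∈ S.allAdded p nbar ∧
        S.selTime p nbar nmax h (k + 1) = m} := by
    rw [runMeasure_apply, ← S.expect_past hm]
    refine S.expect_congr fun h hh => ?_
    have : h.past m ∈ C ↔ h ∈ {h | h ∈ S.allAdded p nbar ∧
        S.selTime p nbar nmax h (k + 1) = m} :=
      (and_iff_left (h.length_past (hm.trans (S.length_of_mem_support hh).ge))).trans (hpast h)
    classical
    simp only [Set.indicator_apply, this, Pi.one_apply]
  rw [hPC] at hle
  have hmiss : S.runMeasure nmax {h | h ∈ S.allAdded p nbar ∧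
      S.selTime p nbar nmax h (k + 1) = m ∧ ¬ S.selTime p nbar nmax h (k + 2) ≤ nmax} ≤
      _ := le_trans (by
        rw [runMeasure_apply]
        refine S.expect_mono fun h hh => ?_
        by_cases hE : h ∈ {h | h ∈ S.allAdded p nbar ∧ S.selTime p nbar nmax h (k + 1) = m ∧
          ¬ S.selTime p nbar nmax h (k + 2) ≤ nmax}
        · rw [Set.indicator_of_mem hE, Set.indicator_of_mem]
          refine ⟨⟨(hpast h).2 ⟨hE.1, hE.2.1⟩,
            h.length_past (hm.trans (S.length_of_mem_support hh).ge)⟩, fun n hn hn' hs => ?_⟩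
          exact hE.2.2 (S.selTime_le_iff.2 ⟨n, hE.2.1.trans_lt hn, hn', hs⟩)
        · rw [Set.indicator_of_notMem hE]
          exact zero_le) hle
  have := ENNReal.toReal_mono (ENNReal.mul_ne_top ENNReal.ofReal_ne_top
    (MeasureTheory.measure_ne_top _ _)) hmiss
  rwa [ENNReal.toReal_mul, ENNReal.toReal_ofReal (Real.exp_nonneg _)] at this

theorem real_mul_tail_le [Finite R] (hp : p.IsChain M.trans) {nbar nmax m k : ℕ}
    (hk : k + 2 ≤ p.length) (hm : m ≤ nmax) (hnm : nbar ≤ m) :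
    (S.runMeasure nmax).real {h | h ∈ S.allAdded p nbar ∧
      S.selTime p nbar nmax h (k + 1) = m} *
        tail (∑ n ∈ Finset.Icc m nmax, S.gamma p n (k + 2)) 1 ≤
    (S.runMeasure nmax).real {h | h ∈ S.allAdded p nbar ∧
      S.selTime p nbar nmax h (k + 1) = m ∧ S.selTime p nbar nmax h (k + 2) ≤ nmax} := by
  set μ := (S.runMeasure nmax).real
  set B := {h | h ∈ S.allAdded p nbar ∧ S.selTime p nbar nmax h (k + 1) = m}
  have hsplit : μ B ≤ μ {h | h ∈ S.allAdded p nbar ∧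
      S.selTime p nbar nmax h (k + 1) = m ∧ S.selTime p nbar nmax h (k + 2) ≤ nmax} +
      μ {h | h ∈ S.allAdded p nbar ∧
      S.selTime p nbar nmax h (k + 1) = m ∧ ¬ S.selTime p nbar nmax h (k + 2) ≤ nmax} := by
    refine le_trans (MeasureTheory.measureReal_mono ?_) (MeasureTheory.measureReal_union_le _ _)
    intro h hh
    by_cases hs : S.selTime p nbar nmax h (k + 2) ≤ nmax
    · exact Or.inl ⟨hh.1, hh.2, hs⟩
    · exact Or.inr ⟨hh.1, hh.2, hs⟩
  have hmiss := S.real_missed_le hp hk hm hnm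
  -- The stated sum includes `n = m`, although waiting starts at `m + 1`; the summand `1` absorbs
  -- this term, since `γ ≤ 1`.
  have hexp : Real.exp (-∑ n ∈ Finset.Ioc m nmax, S.gamma p n (k + 2)) ≤
      Real.exp (-(∑ n ∈ Finset.Icc m nmax, S.gamma p n (k + 2)) / 2 + 1) := by
    refine Real.exp_le_exp.2 ?_
    rw [Finset.Icc_eq_cons_Ioc hm, Finset.sum_cons]
    have h1 := (S.gamma_mem_Ioc hp m hk).2
    have h2 : 0 ≤ ∑ n ∈ Finset.Ioc m nmax, S.gamma p n (k + 2) :=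
      Finset.sum_nonneg fun n _ => (S.gamma_mem_Ioc hp n hk).1.le
    linarith
  have hB : 0 ≤ μ B := MeasureTheory.measureReal_nonneg
  rw [tail, mul_max_of_nonneg _ _ hB, mul_zero]
  refine max_le MeasureTheory.measureReal_nonneg ?_
  have := mul_le_mul_of_nonneg_right hexp hB
  linarith

/-- On each piece where the previous selection time equals `m` the integrand is constant and
`real_mul_tail_le` applies; the pieces are disjoint. -/
theorem setIntegral_tail_le [Finite R] (hp : p.IsChain M.trans) {nbar nmax k : ℕ}
    (hk : k + 2 ≤ p.length) :
    ∫ h in S.reached p nbar nmax (k + 1),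
      tail (∑ n ∈ Finset.Icc (S.selTime p nbar nmax h (k + 1)) nmax, S.gamma p n (k + 2)) 1
        ∂(S.runMeasure nmax) ≤
    (S.runMeasure nmax).real (S.reached p nbar nmax (k + 2)) := by
  classical
  set B : ℕ → Set (History ι R) := fun m =>
    {h | h ∈ S.allAdded p nbar ∧ S.selTime p nbar nmax h (k + 1) = m}
  set B' : ℕ → Set (History ι R) := fun m => {h | h ∈ S.allAdded p nbar ∧
    S.selTime p nbar nmax h (k + 1) = m ∧ S.selTime p nbar nmax h (k + 2) ≤ nmax}
  have hunion : S.reached p nbar nmax (k + 1) = ⋃ m ∈ Finset.Ioc nbar nmax, B m := by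
    ext h
    simp only [Set.mem_iUnion, Finset.mem_Ioc, exists_prop]
    constructor
    · rintro ⟨hA, hs⟩
      exact ⟨_, ⟨S.lt_selTime hs, hs⟩, hA, rfl⟩
    · rintro ⟨m, hm, hA, rfl⟩
      exact ⟨hA, hm.2⟩
  have hunion' : ⋃ m ∈ Finset.Ioc nbar nmax, B' m ⊆ S.reached p nbar nmax (k + 2) := by
    intro h hh
    simp only [Set.mem_iUnion] at hh
    obtain ⟨m, _, hA, _, hs⟩ := hh
    exact ⟨hA, hs⟩
  have hint : ∀ m, ∫ h in B m,
      tail (∑ n ∈ Finset.Icc (S.selTime p nbar nmax h (k + 1)) nmax, S.gamma p n (k + 2)) 1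
        ∂(S.runMeasure nmax) =
      (S.runMeasure nmax).real (B m) *
        tail (∑ n ∈ Finset.Icc m nmax, S.gamma p n (k + 2)) 1 := by
    intro m
    rw [MeasureTheory.setIntegral_congr_fun (g := fun _ =>
      tail (∑ n ∈ Finset.Icc m nmax, S.gamma p n (k + 2)) 1) MeasurableSet.of_discrete,
      MeasureTheory.setIntegral_const, smul_eq_mul]
    rintro h ⟨_, hs⟩
    simp only [hs]
  have hbound : MeasureTheory.Integrable (fun h =>
      tail (∑ n ∈ Finset.Icc (S.selTime p nbar nmax h (k + 1)) nmax, S.gamma p n (k + 2)) 1)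
        (S.runMeasure nmax) := by
    refine MeasureTheory.Integrable.of_bound
      (Measurable.of_discrete.aestronglyMeasurable) 1 (Filter.Eventually.of_forall fun h => ?_)
    rw [Real.norm_of_nonneg (tail_nonneg _ _)]
    exact tail_le_one _ _
  rw [hunion, MeasureTheory.integral_biUnion_finset _ (fun _ _ => MeasurableSet.of_discrete) _
    fun _ _ => hbound.integrableOn]
  · refine le_trans (Finset.sum_le_sum fun m hm => ?_) (le_of_eq_of_le
      (MeasureTheory.measureReal_biUnion_finset (f := B') ?_
        fun _ _ => MeasurableSet.of_discrete).symm (MeasureTheory.measureReal_mono hunion'))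
    · rw [Finset.mem_Ioc] at hm
      rw [hint]
      exact S.real_mul_tail_le hp hk hm.2 hm.1.le
    · intro m _ m' _ hne
      refine Set.disjoint_left.2 ?_
      rintro h ⟨_, rfl, _⟩ ⟨_, hs, _⟩
      exact hne hs
  · intro m _ m' _ hne
    refine Set.disjoint_left.2 ?_
    rintro h ⟨_, rfl⟩ ⟨_, hs⟩
    exact hne hs

theorem integral_cond_mul_le [Finite R] (hp : p.IsChain M.trans) {nbar nmax k : ℕ}
    (hk : k + 1 < p.length) (hn : nbar + p.length ≤ nmax) :
    (∫ h, tail (∑ n ∈ Finset.Icc (S.selTime p nbar nmax h k) nmax, S.gamma p n (k + 1)) 1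
      ∂(S.runMeasure nmax)[|S.reached p nbar nmax k]) *
      (S.runMeasure nmax).real (S.reached p nbar nmax k) ≤
    (S.runMeasure nmax).real (S.reached p nbar nmax (k + 1)) := by
  have hI : ∀ f : History ι R → ℝ, (∫ h, f h ∂(S.runMeasure nmax)[|S.reached p nbar nmax k]) =
      ((S.runMeasure nmax).real (S.reached p nbar nmax k))⁻¹ *
        ∫ h in S.reached p nbar nmax k, f h ∂(S.runMeasure nmax) := fun f => by
    rw [ProbabilityTheory.cond, MeasureTheory.integral_smul_measure, smul_eq_mul,
      ENNReal.toReal_inv]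
    rfl
  rw [hI]
  rcases eq_or_ne ((S.runMeasure nmax).real (S.reached p nbar nmax k)) 0 with h0 | h0
  · rw [h0, mul_zero]; exact MeasureTheory.measureReal_nonneg
  rw [mul_comm, ← mul_assoc, mul_inv_cancel₀ h0, one_mul]
  match k with
  | k + 1 => exact S.setIntegral_tail_le hp hk.le
  -- The first factor is at most `1`, and `n_1 = nbar + 1` never exceeds `nmax`.
  | 0 =>
    have hsub : S.reached p nbar nmax 0 ⊆ S.reached p nbar nmax 1 := fun h hh =>
      ⟨hh.1, show nbar + 1 ≤ nmax by omega⟩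
    refine le_trans ?_ (MeasureTheory.measureReal_mono hsub)
    have := MeasureTheory.norm_setIntegral_le_of_norm_le_const
      (μ := S.runMeasure nmax) (s := S.reached p nbar nmax 0) (C := 1)
      (f := fun h => tail (∑ n ∈ Finset.Icc (S.selTime p nbar nmax h 0) nmax,
        S.gamma p n (0 + 1)) 1) (MeasureTheory.measure_lt_top _ _) fun h _ => by
          rw [Real.norm_of_nonneg (tail_nonneg _ _)]
          exact tail_le_one _ _
    rw [one_mul] at this
    exact (le_abs_self _).trans this

theorem rateBound_le_reached [Finite R] (hp : p.IsChain M.trans) (hr : p.head? = some r)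
    {nbar nmax : ℕ} (hn : nbar + p.length ≤ nmax) :
    S.rateBound p nbar nmax ≤
      (S.runMeasure nmax).real (S.reached p nbar nmax (p.length - 1)) := by
  have hind : ∀ k, k + 1 ≤ p.length →
      (∏ j ∈ Finset.Ico 1 (k + 1), ∫ h,
        tail (∑ n ∈ Finset.Icc (S.selTime p nbar nmax h (j - 1)) nmax, S.gamma p n j) 1
          ∂(S.runMeasure nmax)[|S.reached p nbar nmax (j - 1)]) *
        tail (∑ n ∈ Finset.Icc 1 nbar, S.alpha p n) p.length ≤
      (S.runMeasure nmax).real (S.reached p nbar nmax k) := by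
    intro k
    induction k with
    | zero =>
      intro _
      rw [Finset.Ico_self, Finset.prod_empty, one_mul]
      have : S.reached p nbar nmax 0 = S.allAdded p nbar :=
        Set.inter_eq_left.2 fun h _ => show nbar ≤ nmax by omega
      rw [this]
      exact S.tail_le_runMeasure_allAdded hp hr (by omega)
    | succ k ih =>
      intro hk
      rw [Finset.prod_Ico_succ_top (by omega), mul_right_comm, mul_comm]
      refine le_trans ?_ (S.integral_cond_mul_le hp hk hn)
      exact mul_le_mul_of_nonneg_left (ih (by omega))
        (MeasureTheory.integral_nonneg fun _ => tail_nonneg _ _)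
  have hpos : 1 ≤ p.length := by cases p <;> simp_all
  have := hind (p.length - 1) (by omega)
  rwa [Nat.sub_add_cancel hpos] at this

/-- The law after `n` iterations is carried by histories of length `n`, so an inclusion has to be
checked only there. -/
theorem real_mono_of_length {n : ℕ} {E F : Set (History ι R)}
    (hEF : ∀ h : History ι R, h.length = n → h ∈ E → h ∈ F) :
    (S.runMeasure n).real E ≤ (S.runMeasure n).real F := by
  classical
  refine ENNReal.toReal_mono (MeasureTheory.measure_ne_top _ _) ?_
  rw [runMeasure_apply, runMeasure_apply]
  refine S.expect_mono fun h hh => ?_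
  by_cases hE : h ∈ E
  · simp [hE, hEF h (S.length_of_mem_support hh) hE]
  · simp [hE]

end Sampler

end Rate

end Stylus

theorem mainTheorem2 {ι R QB : Type*} [Fintype ι] [Fintype R] [Fintype QB]
    (M : Stylus.Model ι R QB) (β : ℝ) (hβ₀ : 0 ≤ β) (hβ₁ : β ≤ 1)
    (p : List (Stylus.PState ι R QB)) (hp : M.IsOptimalPart β p)
    (r g : Stylus.PState ι R QB) (hr : p.head? = some r) (hg : p.getLast? = some g)
    (S : Stylus.Sampler M r) :
    (∀ n, 1 ≤ n → S.alpha p n ∈ Set.Ioc (0 : ℝ) 1) ∧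
    (∀ n k, 1 ≤ n → 1 ≤ k → k ≤ p.length → S.gamma p n k ∈ Set.Ioc (0 : ℝ) 1) ∧
    ∀ nmax nbar : ℕ, 2 * p.length < nmax → nbar + p.length ≤ nmax →
      S.rateBound p nbar nmax ≤ (S.runMeasure nmax).real (S.detects p g) ∧
      ((∀ p', M.IsPath r g p' → M.pathCost p' ≤ M.pathCost p → p' = p) →
        S.rateBound p nbar nmax ≤
          (S.runMeasure nmax).real
            {h | g ∈ (h.tree M r).nodes ∧ (h.tree M r).branch g = p}) := by
  obtain ⟨hpath, hopt⟩ := hp.isPath_and_le hr hg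
  refine ⟨fun n _ => S.alpha_mem_Ioc hpath.chain hr n,
    fun n k _ _ hk => S.gamma_mem_Ioc hpath.chain n hk, fun nmax nbar _ hn => ?_⟩
  have hbound := S.rateBound_le_reached hpath.chain hr hn
  have hdet : ∀ h : Stylus.History ι R, h.length = nmax →
      h ∈ S.reached p nbar nmax (p.length - 1) → h ∈ S.detects p g := fun h hlen hh =>
    have := S.cost_le_of_selTime_le hpath hlen hh.1 (by omega) hh.2
    S.detects_of_cost_le hopt this.1 this.2
  refine ⟨hbound.trans (S.real_mono_of_length hdet), fun huniq =>
    hbound.trans (S.real_mono_of_length fun h hlen hh => ?_)⟩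
  obtain ⟨hmem, hbr, hc⟩ := hdet h hlen hh
  exact ⟨hmem, huniq _ hbr hc.le⟩
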